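/- For $x\in\mathbb{R}$ write $\langle x\rangle=(1+x^2)^{1/2}$, and for a Schwartz function $u\in\mathcal{S}(\mathbb{R}^2)$ of $(t,x)$ (complex valued) let $$\mathcal{F}u(\tau,\xi)=(2\pi)^{-1}\int_{\mathbb{R}^2}e^{-i(t\tau+x\xi)}u(t,x)\,dt\,dx .$$ For $1<\alpha<2$, $0\le\omega<\tfrac12$ and $s,b\in\mathbb{R}$ define the weighted Bourgain norm $$\|u\|_{X_{s,\omega,b}}=\Big(\int_{\mathbb{R}^2}|\xi|^{-2\omega}\langle\xi\rangle^{2s-2\alpha\omega}\big\langle|\tau|+|\xi|^{1+\alpha}\big\rangle^{2\omega}\big\langle\tau-\xi|\xi|^{\alpha}\big\rangle^{2b}\,|\mathcal{F}u(\tau,\xi)|^2\,d\tau\,d\xi\Big)^{1/2}.$$ **Theorem.** Let $1<\alpha<2$, $s\ge s_0>-\tfrac34(\alpha-1)$ and $\omega=\tfrac1\alpha-\tfrac12$. Then there exist $b'>-\tfrac12$, $b\in(\tfrac12,b'+1)$ and a constant $c\ge 0$ such that $$\|\partial_x(u_1u_2)\|_{X_{s,\omega,b'}}\le c\,\Big(\|u_1\|_{X_{s,\omega,b}}\|u_2\|_{X_{s_0,\omega,b}}+\|u_1\|_{X_{s_0,\omega,b}}\|u_2\|_{X_{s,\omega,b}}\Big)$$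 for all $u_1,u_2\in\mathcal{S}(\mathbb{R}^2)$. -/

import Mathlib

open MeasureTheory
open scoped SchwartzMap ENNReal NNReal

noncomputable section

/-- The bracket `⟨x⟩ = (1 + x²)^{1/2}`. -/
def jbracket (x : ℝ) : ℝ := Real.sqrt (1 + x ^ 2)

/-- The space-time Fourier transform
`(2π)⁻¹ ∫ e^{-i(tτ + xξ)} u(t, x) dt dx` of a function of `(t, x)`, at the point `(τ, ξ)`. -/
def spacetimeFourier (u : ℝ × ℝ → ℂ) (q : ℝ × ℝ) : ℂ :=
  ((2 * Real.pi : ℝ) : ℂ)⁻¹ *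
    ∫ p : ℝ × ℝ, Complex.exp (-(Complex.I * ((p.1 * q.1 + p.2 * q.2 : ℝ) : ℂ))) * u p

/-- The weight `|ξ|^{-2ω} ⟨ξ⟩^{2s-2αω} ⟨|τ|+|ξ|^{1+α}⟩^{2ω} ⟨τ-ξ|ξ|^α⟩^{2b}` at `q = (τ, ξ)`. -/
def bourgainWeight (α s ω b : ℝ) (q : ℝ × ℝ) : ℝ :=
  |q.2| ^ (-(2 * ω)) * jbracket q.2 ^ (2 * s - 2 * α * ω) *
    jbracket (|q.1| + |q.2| ^ (1 + α)) ^ (2 * ω) *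
    jbracket (q.1 - q.2 * |q.2| ^ α) ^ (2 * b)

/-- The norm of `X_{s,ω,b}` (for the dispersion exponent `α`), as an extended nonnegative real:
the square root of the integral of the weight times `|𝓕u(τ, ξ)|²` over `ℝ²`. -/
def bourgainNorm (α s ω b : ℝ) (u : ℝ × ℝ → ℂ) : ℝ≥0∞ :=
  (∫⁻ q : ℝ × ℝ, ENNReal.ofReal (bourgainWeight α s ω b q * ‖spacetimeFourier u q‖ ^ 2))
    ^ (1 / 2 : ℝ)

/-- The partial derivative in the space variable `x` of a function of `(t, x)`. -/
def partialX (u : ℝ × ℝ → ℂ) (p : ℝ × ℝ) : ℂ := deriv (fun x : ℝ => u (p.1, x)) p.2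

end

/-! On the Fourier side the claim is a weighted `L²` bound for a convolution. The input frequencies
`a`, `c` and the reflected output frequency `-(a + c)` sum to zero, and two mechanisms pay for the
derivative.

Resonance. With `φ(ξ) = ξ|ξ|^α` and modulation `σ = τ - φ(ξ)`, one has `σ₀ - σ₁ - σ₂ = φ(ξ₁) + φ(ξ₂)
- φ(ξ₀)`, whose modulus is at least of order `|ξ_min| |ξ_max|^α` (`mul_rpow_le_abs_resonance`). The
largest modulation is therefore at least that large, and the exponent `b'` near `-1/2` turns it into
decay.

Transversality. The two remaining factors behave like free waves, whose interaction gains the square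
root of `||ξ|^α - |η|^α|`, the Jacobian of the phase. Where the waves are almost parallel, the small
measure of the set replaces the Jacobian. `exists_lintegral_bilinearKernel_sq_le` states this as
square integrability of a kernel over pairs with fixed sum, and
`lintegral_sq_convolution_pairSum_le` makes it available for any two of the three frequencies.

What remains is the pointwise bound `exp_logMultiplier_le` of the multiplier by the sum of the three
kernels. In logarithms it is a family of linear inequalities, one per frequency regime. Write `N`
for the largest input frequency and `p = -s₀`. For comparable frequencies the weights give
`N^{1+p}`, the resonance `N^{-(1+α)/2}` and the kernel allows `N^{(α-1)/4}`: this is the threshold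
`p < 3(α-1)/4`, which the high-high-to-low interaction reproduces. When one input is very low, only
the weight `ω` exploits the resonance; it leaves `N^{1-αω}`, which equals the transversal gain
`N^{α/2}` exactly for `ω = 1/α - 1/2`. -/

section Fourier

/-! ### Products and derivatives under the space-time Fourier transform. -/

open FourierTransform LineDeriv Convolution

/-- A Schwartz function on `ℝ × ℝ`, regarded as a function on the inner product space `ℂ`. -/
noncomputable def schwartzOnComplex (u : 𝓢(ℝ × ℝ, ℂ)) : 𝓢(ℂ, ℂ) :=
  SchwartzMap.compCLMOfContinuousLinearEquiv ℂ Complex.equivRealProdCLM u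

/-- The frequency on `ℂ` at which the inverse Fourier transform agrees, up to a constant, with
the space-time Fourier transform at `q`. -/
noncomputable def complexFrequency (q : ℝ × ℝ) : ℂ :=
  (-(2 * Real.pi)⁻¹ : ℝ) • Complex.equivRealProdCLM.symm q

theorem schwartzOnComplex_apply (u : 𝓢(ℝ × ℝ, ℂ)) (z : ℂ) :
    schwartzOnComplex u z = u (z.re, z.im) := rfl

theorem complexFrequency_im (q : ℝ × ℝ) : (complexFrequency q).im = -(2 * Real.pi)⁻¹ * q.2 := by
  simp [complexFrequency]

theorem integral_complex_eq_integral_prod (f : ℂ → ℂ) :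
    ∫ z : ℂ, f z = ∫ p : ℝ × ℝ, f (Complex.equivRealProdCLM.symm p) := by
  have h := (Complex.volume_preserving_equiv_real_prod.symm).integral_comp'
    (g := f)
  exact h.symm

/-- The kernel of `𝓕⁻` is `e^{2πi⟨v,w⟩}`; at `w = -q/(2π)` it becomes `e^{-i(tτ+xξ)}`. -/
theorem spacetimeFourier_eq_fourierInv (f : 𝓢(ℂ, ℂ)) (u : ℝ × ℝ → ℂ)
    (h : ∀ p, u p = f (Complex.equivRealProdCLM.symm p)) (q : ℝ × ℝ) :
    spacetimeFourier u q = ((2 * Real.pi : ℝ) : ℂ)⁻¹ * 𝓕⁻ f (complexFrequency q) := by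
  rw [SchwartzMap.fourierInv_coe, Real.fourierInv_eq', integral_complex_eq_integral_prod,
    spacetimeFourier]
  congr 1
  refine integral_congr_ae (Filter.Eventually.of_forall fun p => ?_)
  simp only [smul_eq_mul, h]
  congr 2
  have hpi : (Real.pi : ℂ) ≠ 0 := by exact_mod_cast Real.pi_ne_zero
  simp only [Complex.inner, complexFrequency]
  simp
  field_simp
  ring

theorem continuous_spacetimeFourier (u : 𝓢(ℝ × ℝ, ℂ)) : Continuous (spacetimeFourier u) := by
  have h : spacetimeFourier u = fun q => ((2 * Real.pi : ℝ) : ℂ)⁻¹ *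
      𝓕⁻ (schwartzOnComplex u) (complexFrequency q) := by
    funext q
    exact spacetimeFourier_eq_fourierInv _ _ (fun p => by simp [schwartzOnComplex_apply]) q
  rw [h]
  refine continuous_const.mul ((𝓕⁻ (schwartzOnComplex u)).continuous.comp ?_)
  unfold complexFrequency
  fun_prop

/-- A Schwartz convolution is `𝓕⁻` of the product of the transforms, so applied to `𝓕⁻ f` and `𝓕⁻ g`
the inner transforms cancel. This is the reason for working with `𝓕⁻`. -/
theorem fourierInv_pairing_eq_integral (f g : 𝓢(ℂ, ℂ)) (z : ℂ) :
    𝓕⁻ (SchwartzMap.pairing (ContinuousLinearMap.mul ℂ ℂ) f g) z =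
      ∫ w : ℂ, 𝓕⁻ f w * 𝓕⁻ g (z - w) := by
  have h := SchwartzMap.convolution_apply (ContinuousLinearMap.mul ℂ ℂ) (𝓕⁻ f) (𝓕⁻ g) z
  have h2 : SchwartzMap.convolution (ContinuousLinearMap.mul ℂ ℂ) (𝓕⁻ f) (𝓕⁻ g) =
      𝓕⁻ (SchwartzMap.pairing (ContinuousLinearMap.mul ℂ ℂ) f g) := by
    simp [SchwartzMap.convolution]
  rw [← h2, h]
  rfl

theorem integral_comp_complexFrequency (F : ℂ → ℂ) :
    ∫ z : ℂ, F z = ((2 * Real.pi : ℝ) : ℂ)⁻¹ ^ 2 * ∫ q : ℝ × ℝ, F (complexFrequency q) := by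
  have h := Measure.integral_comp_smul (volume : Measure (ℝ × ℝ))
    (fun p => F (Complex.equivRealProdCLM.symm p)) (-(2 * Real.pi)⁻¹)
  rw [integral_complex_eq_integral_prod]
  have h3 : (∫ q : ℝ × ℝ, F (complexFrequency q)) = ∫ x : ℝ × ℝ,
      F (Complex.equivRealProdCLM.symm ((-(2 * Real.pi)⁻¹) • x)) := by
    simp only [complexFrequency, map_smul]
  rw [h3, h]
  have hpi : (Real.pi : ℂ) ≠ 0 := by exact_mod_cast Real.pi_ne_zero
  simp
  rw [abs_of_pos Real.pi_pos]
  field_simp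

/-- The Fourier transform turns products into convolutions and `∂ₓ` into multiplication. -/
theorem spacetimeFourier_partialX_mul (u₁ u₂ : 𝓢(ℝ × ℝ, ℂ)) (q : ℝ × ℝ) :
    spacetimeFourier (partialX fun p => u₁ p * u₂ p) q =
      Complex.I * q.2 * ((2 * Real.pi : ℝ) : ℂ)⁻¹ *
        ∫ r : ℝ × ℝ, spacetimeFourier u₁ r * spacetimeFourier u₂ (q - r) := by
  set f₁ := schwartzOnComplex u₁
  set f₂ := schwartzOnComplex u₂
  set v := SchwartzMap.pairing (ContinuousLinearMap.mul ℂ ℂ) f₁ f₂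
  have hv : ∀ p, partialX (fun p => u₁ p * u₂ p) p =
      (∂_{(Complex.I : ℂ)} v) (Complex.equivRealProdCLM.symm p) := by
    intro p
    rw [SchwartzMap.lineDerivOp_apply, lineDeriv, partialX]
    have h := deriv_comp_add_const (fun x => u₁ (p.1, x) * u₂ (p.1, x)) p.2 0
    rw [zero_add] at h
    rw [← h]
    congr 1
    funext t
    simp [v, f₁, f₂, schwartzOnComplex_apply, add_comm]
  have h1 : ∀ r, spacetimeFourier u₁ r = ((2 * Real.pi : ℝ) : ℂ)⁻¹ * 𝓕⁻ f₁ (complexFrequency r) :=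
    spacetimeFourier_eq_fourierInv _ _ (fun p => by simp [f₁, schwartzOnComplex_apply])
  have h2 : ∀ r, spacetimeFourier u₂ r = ((2 * Real.pi : ℝ) : ℂ)⁻¹ * 𝓕⁻ f₂ (complexFrequency r) :=
    spacetimeFourier_eq_fourierInv _ _ (fun p => by simp [f₂, schwartzOnComplex_apply])
  have hsub : ∀ r, complexFrequency (q - r) = complexFrequency q - complexFrequency r := by
    intro r; simp [complexFrequency, smul_sub]
  rw [spacetimeFourier_eq_fourierInv _ _ hv, SchwartzMap.fourierInv_lineDerivOp_eq]
  have htemp : (inner ℝ · Complex.I : ℂ → ℝ).HasTemperateGrowth := by fun_prop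
  simp only [h1, h2, hsub]
  have h5 : ∀ r, ((2 * Real.pi : ℝ) : ℂ)⁻¹ * 𝓕⁻ f₁ (complexFrequency r) *
      (((2 * Real.pi : ℝ) : ℂ)⁻¹ * 𝓕⁻ f₂ (complexFrequency q - complexFrequency r)) =
      ((2 * Real.pi : ℝ) : ℂ)⁻¹ ^ 2 * (𝓕⁻ f₁ (complexFrequency r) *
        𝓕⁻ f₂ (complexFrequency q - complexFrequency r)) := fun r => by ring
  simp only [h5]
  rw [integral_const_mul, ← integral_comp_complexFrequency
    (fun z => 𝓕⁻ f₁ z * 𝓕⁻ f₂ (complexFrequency q - z)),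
    ← fourierInv_pairing_eq_integral]
  have hpi : (Real.pi : ℂ) ≠ 0 := by exact_mod_cast Real.pi_ne_zero
  have h6 : inner ℝ (complexFrequency q) Complex.I = -(2 * Real.pi)⁻¹ * q.2 := by
    simp [Complex.inner, complexFrequency_im]
  simp only [smul_apply, SchwartzMap.smulLeftCLM_apply_apply htemp, h6, smul_eq_mul]
  simp only [v, Complex.real_smul]
  push_cast
  field_simp

theorem enorm_spacetimeFourier_partialX_mul_le (u₁ u₂ : 𝓢(ℝ × ℝ, ℂ)) (q : ℝ × ℝ) :
    ‖spacetimeFourier (partialX fun p => u₁ p * u₂ p) q‖ₑ ≤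
      ‖q.2‖ₑ * ∫⁻ r : ℝ × ℝ, ‖spacetimeFourier u₁ r‖ₑ * ‖spacetimeFourier u₂ (q - r)‖ₑ := by
  rw [spacetimeFourier_partialX_mul, enorm_mul, enorm_mul, enorm_mul]
  have h1 : ‖((2 * Real.pi : ℝ) : ℂ)⁻¹‖ₑ ≤ 1 := by
    rw [← ofReal_norm, ENNReal.ofReal_le_one, norm_inv, Complex.norm_real,
      Real.norm_of_nonneg (by positivity)]
    exact inv_le_one_of_one_le₀ (by nlinarith [Real.pi_gt_three])
  have h2 : ‖Complex.I‖ₑ = 1 := by simp [← ofReal_norm]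
  have h3 : ‖(q.2 : ℂ)‖ₑ = ‖q.2‖ₑ := by simp [← ofReal_norm]
  rw [h2, h3, one_mul]
  refine mul_le_mul' (mul_le_of_le_one_right' h1) ?_
  refine (enorm_integral_le_lintegral_enorm _).trans_eq ?_
  simp only [enorm_mul]

end Fourier

/-! ### The bracket and convolution of its negative powers. -/

section Bracket

theorem one_le_jbracket (x : ℝ) : 1 ≤ jbracket x := by
  rw [jbracket, Real.one_le_sqrt]; nlinarith [sq_nonneg x]

theorem jbracket_pos (x : ℝ) : 0 < jbracket x := zero_lt_one.trans_le (one_le_jbracket x)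

theorem abs_le_jbracket (x : ℝ) : |x| ≤ jbracket x := by
  rw [jbracket]; exact Real.abs_le_sqrt (by linarith)

theorem jbracket_le_one_add_abs (x : ℝ) : jbracket x ≤ 1 + |x| := by
  rw [jbracket, Real.sqrt_le_left (by positivity)]
  nlinarith [sq_abs x, abs_nonneg x]

theorem jbracket_le_of_abs_le {x y : ℝ} (h : |x| ≤ |y|) : jbracket x ≤ jbracket y :=
  Real.sqrt_le_sqrt (by linarith [sq_le_sq.2 h])

theorem jbracket_neg (x : ℝ) : jbracket (-x) = jbracket x := by simp [jbracket]

theorem jbracket_add_le (x y : ℝ) : jbracket (x + y) ≤ jbracket x + jbracket y := by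
  have hx := abs_le_jbracket x
  have hy := abs_le_jbracket y
  have h1 := Real.sq_sqrt (show 0 ≤ 1 + x ^ 2 by positivity)
  have h2 := Real.sq_sqrt (show 0 ≤ 1 + y ^ 2 by positivity)
  change jbracket x ^ 2 = _ at h1
  change jbracket y ^ 2 = _ at h2
  have h3 : |x| * |y| ≤ jbracket x * jbracket y :=
    mul_le_mul hx hy (abs_nonneg _) (jbracket_pos x).le
  rw [← abs_mul] at h3
  have h4 := le_abs_self (x * y)
  rw [jbracket, Real.sqrt_le_left (add_pos (jbracket_pos x) (jbracket_pos y)).le]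
  nlinarith

@[fun_prop]
theorem continuous_jbracket : Continuous jbracket := by
  unfold jbracket; fun_prop

@[fun_prop]
theorem measurable_jbracket : Measurable jbracket := continuous_jbracket.measurable

theorem jbracket_rpow_neg_le_one {b : ℝ} (hb : 0 ≤ b) (x : ℝ) : jbracket x ^ (-b) ≤ 1 :=
  Real.rpow_le_one_of_one_le_of_nonpos (one_le_jbracket x) (by linarith)

theorem lintegral_jbracket_rpow_neg_lt_top {β : ℝ} (hβ : 1 < β) :
    ∫⁻ x, ENNReal.ofReal (jbracket x ^ (-β)) < ∞ := by
  have h := integrable_rpow_neg_one_add_norm_sq (E := ℝ) (μ := volume) (r := β) (by simpa using hβ)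
  have h2 : (fun x : ℝ => jbracket x ^ (-β)) = fun x => (1 + ‖x‖ ^ 2) ^ (-β / 2) := by
    funext x
    rw [jbracket, Real.sqrt_eq_rpow, ← Real.rpow_mul (by positivity), Real.norm_eq_abs, sq_abs]
    congr 1; ring
  rw [← h2] at h
  exact h.lintegral_lt_top

/-- The larger of the two brackets is at least `⟨c - a⟩ / 2`; the other one keeps its decay. -/
theorem jbracket_rpow_mul_le {β : ℝ} (hβ : 0 ≤ β) (a c x : ℝ) :
    jbracket (x - a) ^ (-β) * jbracket (c - x) ^ (-β) ≤
      2 ^ β * jbracket (c - a) ^ (-β) *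
        (jbracket (x - a) ^ (-β) + jbracket (c - x) ^ (-β)) := by
  have h := jbracket_add_le (x - a) (c - x)
  rw [show x - a + (c - x) = c - a by ring] at h
  have key : ∀ {y : ℝ}, 0 < y → jbracket (c - a) ≤ 2 * y →
      y ^ (-β) ≤ 2 ^ β * jbracket (c - a) ^ (-β) := by
    intro y hy hle
    have h1 : (2 * y) ^ (-β) ≤ jbracket (c - a) ^ (-β) :=
      Real.rpow_le_rpow_of_nonpos (jbracket_pos _) hle (by linarith)
    rw [Real.mul_rpow (by norm_num) hy.le, Real.rpow_neg (by norm_num)] at h1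
    have h2 : (0 : ℝ) < 2 ^ β := by positivity
    calc y ^ (-β) = 2 ^ β * ((2 ^ β)⁻¹ * y ^ (-β)) := by field_simp
      _ ≤ _ := by gcongr
  have hA : 0 ≤ jbracket (x - a) ^ (-β) := (Real.rpow_pos_of_pos (jbracket_pos _) _).le
  have hB : 0 ≤ jbracket (c - x) ^ (-β) := (Real.rpow_pos_of_pos (jbracket_pos _) _).le
  have hC : 0 ≤ 2 ^ β * jbracket (c - a) ^ (-β) :=
    mul_nonneg (by positivity) (Real.rpow_pos_of_pos (jbracket_pos _) _).le
  rcases le_total (jbracket (x - a)) (jbracket (c - x)) with h1 | h1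
  · have := key (jbracket_pos (c - x)) (by linarith)
    nlinarith
  · have := key (jbracket_pos (x - a)) (by linarith)
    nlinarith

theorem lintegral_jbracket_mul_le {β : ℝ} (hβ : 0 ≤ β) (a c : ℝ) :
    ∫⁻ x, ENNReal.ofReal (jbracket (x - a) ^ (-β)) * ENNReal.ofReal (jbracket (c - x) ^ (-β)) ≤
      ENNReal.ofReal (2 ^ β) * (2 * ∫⁻ x, ENNReal.ofReal (jbracket x ^ (-β))) *
        ENNReal.ofReal (jbracket (c - a) ^ (-β)) := by
  have hnn : ∀ y, 0 ≤ jbracket y ^ (-β) := fun y => (Real.rpow_pos_of_pos (jbracket_pos _) _).le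
  calc _ ≤ ∫⁻ x, ENNReal.ofReal (2 ^ β * jbracket (c - a) ^ (-β)) *
        (ENNReal.ofReal (jbracket (x - a) ^ (-β)) + ENNReal.ofReal (jbracket (c - x) ^ (-β))) := by
        refine lintegral_mono fun x => ?_
        rw [← ENNReal.ofReal_mul (hnn _), ← ENNReal.ofReal_add (hnn _) (hnn _),
          ← ENNReal.ofReal_mul (mul_nonneg (by positivity) (hnn _))]
        exact ENNReal.ofReal_le_ofReal (jbracket_rpow_mul_le hβ a c x)
    _ = _ := by
        rw [lintegral_const_mul _ (by fun_prop), lintegral_add_left (by fun_prop),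
          lintegral_sub_right_eq_self (fun x => ENNReal.ofReal (jbracket x ^ (-β))) a,
          lintegral_sub_left_eq_self (fun x => ENNReal.ofReal (jbracket x ^ (-β))) c,
          ENNReal.ofReal_mul (by positivity)]
        ring

end Bracket

/-! ### Schur tests for weighted convolutions. -/

section Bilinear

variable {κ : ℝ × ℝ → ℝ × ℝ → ℝ≥0∞} {f g : ℝ × ℝ → ℝ≥0∞} {C : ℝ≥0∞}

theorem sq_lintegral_mul_le {X : Type*} [MeasurableSpace X] {μ : Measure X} {f g : X → ℝ≥0∞}
    (hf : AEMeasurable f μ) (hg : AEMeasurable g μ) :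
    (∫⁻ x, f x * g x ∂μ) ^ 2 ≤ (∫⁻ x, f x ^ 2 ∂μ) * ∫⁻ x, g x ^ 2 ∂μ := by
  have h := ENNReal.lintegral_mul_le_Lp_mul_Lq μ Real.HolderConjugate.two_two hf hg
  calc _ ≤ ((∫⁻ x, f x ^ (2 : ℝ) ∂μ) ^ (1 / 2 : ℝ) * (∫⁻ x, g x ^ (2 : ℝ) ∂μ) ^ (1 / 2 : ℝ)) ^ 2 :=
        pow_le_pow_left' h 2
    _ = _ := by
        rw [mul_pow, ← ENNReal.rpow_natCast, ← ENNReal.rpow_natCast, ← ENNReal.rpow_mul,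
          ← ENNReal.rpow_mul]
        norm_num

/-- Schur's test for a kernel that is square integrable along the lines with fixed sum. -/
theorem lintegral_sq_convolution_le_of_sum (hκ : Measurable (Function.uncurry κ))
    (hf : Measurable f) (hg : Measurable g) (hC : ∀ q, ∫⁻ r, κ r (q - r) ^ 2 ≤ C) :
    ∫⁻ q, (∫⁻ r, κ r (q - r) * (f r * g (q - r))) ^ 2 ≤
      C * ((∫⁻ r, f r ^ 2) * ∫⁻ r, g r ^ 2) := by
  have hκ' : ∀ q, Measurable fun r => κ r (q - r) := fun q =>
    hκ.comp (measurable_id.prodMk (measurable_const.sub measurable_id))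
  calc _ ≤ ∫⁻ q, C * ∫⁻ r, f r ^ 2 * g (q - r) ^ 2 := by
        refine lintegral_mono fun q => ?_
        refine (sq_lintegral_mul_le (hκ' q).aemeasurable (by fun_prop)).trans ?_
        simp only [mul_pow]
        exact mul_le_mul_left (hC q) _
    _ = C * ∫⁻ q, ∫⁻ r, f r ^ 2 * g (q - r) ^ 2 := by
        rw [lintegral_const_mul]
        exact Measurable.lintegral_prod_right' (f := fun p : (ℝ × ℝ) × (ℝ × ℝ) =>
          f p.2 ^ 2 * g (p.1 - p.2) ^ 2) (by fun_prop)
    _ = _ := by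
        rw [lintegral_lintegral_swap (by fun_prop), ← lintegral_mul_const _ (by fun_prop)]
        congr 2
        funext r
        rw [lintegral_const_mul _ (by fun_prop), lintegral_sub_right_eq_self (fun q => g q ^ 2) r]

/-- Schur's test for a kernel that depends on the output and is square integrable in it. -/
theorem lintegral_sq_convolution_le_of_output (hκ : Measurable (Function.uncurry κ))
    (hf : Measurable f) (hg : Measurable g) (hC : ∀ r, ∫⁻ q, κ q r ^ 2 ≤ C) :
    ∫⁻ q, (∫⁻ r, κ q r * (f r * g (q - r))) ^ 2 ≤
      C * ((∫⁻ r, f r ^ 2) * ∫⁻ r, g r ^ 2) := by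
  have hκ' : ∀ q, Measurable (κ q) := fun q => hκ.comp (measurable_const.prodMk measurable_id)
  have hκ'' : ∀ r, Measurable (fun q => κ q r) := fun q =>
    hκ.comp (measurable_id.prodMk measurable_const)
  have hm : Measurable fun p : (ℝ × ℝ) × (ℝ × ℝ) => (κ p.1 p.2 * f p.2) ^ 2 :=
    (hκ.mul (hf.comp measurable_snd)).pow_const 2
  calc _ ≤ ∫⁻ q, (∫⁻ r, g r ^ 2) * ∫⁻ r, (κ q r * f r) ^ 2 := by
        refine lintegral_mono fun q => ?_
        -- Grouping `κ` with `f` leaves a `g` factor independent of `q` by translation invariance,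
        -- so `κ²` is later integrated in `q` with `r` fixed.
        have h := sq_lintegral_mul_le (μ := volume) (f := fun r => κ q r * f r)
          (g := fun r => g (q - r)) ((hκ' q).mul hf).aemeasurable (by fun_prop)
        rw [lintegral_sub_left_eq_self (fun r => g r ^ 2) q] at h
        simp only [mul_assoc] at h
        rw [mul_comm (∫⁻ r, g r ^ 2)]
        simpa only [mul_assoc] using h
    _ = (∫⁻ r, g r ^ 2) * ∫⁻ q, ∫⁻ r, (κ q r * f r) ^ 2 := by
        rw [lintegral_const_mul]
        exact Measurable.lintegral_prod_right' hm
    _ ≤ (∫⁻ r, g r ^ 2) * (C * ∫⁻ r, f r ^ 2) := by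
        gcongr
        rw [lintegral_lintegral_swap hm.aemeasurable, ← lintegral_const_mul _ (by fun_prop)]
        refine lintegral_mono fun r => ?_
        simp only [mul_pow]
        rw [lintegral_mul_const _ ((hκ'' r).pow_const 2)]
        exact mul_le_mul_left (hC r) _
    _ = _ := by ring

/-- The sum of a kernel over the pairs of the three frequencies `r`, `q - r`, `-q`. -/
def pairSum (κ : ℝ × ℝ → ℝ × ℝ → ℝ≥0∞) (q r : ℝ × ℝ) : ℝ≥0∞ :=
  κ r (q - r) + κ (-q) r + κ (-q) (q - r)

theorem measurable_pairSum (hκ : Measurable (Function.uncurry κ)) :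
    Measurable (Function.uncurry (pairSum κ)) := by
  have h : ∀ {F G : (ℝ × ℝ) × (ℝ × ℝ) → ℝ × ℝ}, Measurable F → Measurable G →
      Measurable fun p => κ (F p) (G p) := fun hF hG => hκ.comp (hF.prodMk hG)
  unfold pairSum Function.uncurry
  exact ((h (by fun_prop) (by fun_prop)).add (h (by fun_prop) (by fun_prop))).add
    (h (by fun_prop) (by fun_prop))

/-- The pair `-q`, `q - r` has the sum `-r`, so the fixed-sum hypothesis also controls integration
over the output; the pair `-q`, `r` follows by exchanging `f` and `g`. The constant is `9 * 3`. -/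
theorem lintegral_sq_convolution_pairSum_le (hκ : Measurable (Function.uncurry κ))
    (hf : Measurable f) (hg : Measurable g) (hC : ∀ q, ∫⁻ r, κ r (q - r) ^ 2 ≤ C) :
    ∫⁻ q, (∫⁻ r, pairSum κ q r * (f r * g (q - r))) ^ 2 ≤
      27 * C * ((∫⁻ r, f r ^ 2) * ∫⁻ r, g r ^ 2) := by
  have h : ∀ {F G : (ℝ × ℝ) × (ℝ × ℝ) → ℝ × ℝ}, Measurable F → Measurable G →
      Measurable fun p => κ (F p) (G p) := fun hF hG => hκ.comp (hF.prodMk hG)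
  have h' : ∀ {F G : ℝ × ℝ → ℝ × ℝ}, Measurable F → Measurable G →
      Measurable fun p => κ (F p) (G p) := fun hF hG => hκ.comp (hF.prodMk hG)
  have hout : ∀ r, ∫⁻ q, κ (-q) (q - r) ^ 2 ≤ C := by
    intro r
    rw [← lintegral_neg_eq_self]
    refine le_of_eq_of_le ?_ (hC (-r))
    refine lintegral_congr fun q => ?_
    rw [neg_neg, show -q - r = -r - q by abel]
  have h1 := lintegral_sq_convolution_le_of_sum hκ hf hg hC
  have h2 := lintegral_sq_convolution_le_of_output (κ := fun q r => κ (-q) (q - r))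
    (h (by fun_prop) (by fun_prop)) hf hg hout
  have h3 := lintegral_sq_convolution_le_of_output (κ := fun q r => κ (-q) (q - r))
    (h (by fun_prop) (by fun_prop)) hg hf hout
  have h4 : ∀ q, ∫⁻ r, κ (-q) (q - r) * (g r * f (q - r)) =
      ∫⁻ r, κ (-q) r * (f r * g (q - r)) := by
    intro q
    rw [← lintegral_sub_left_eq_self _ q]
    simp [mul_comm]
  simp only [h4] at h3
  have hsq : ∀ a b c : ℝ≥0∞, (a + b + c) ^ 2 ≤ 9 * (a ^ 2 + b ^ 2 + c ^ 2) := by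
    intro a b c
    have hm : a + b + c ≤ 3 * max a (max b c) := by
      have : (3 : ℝ≥0∞) = 1 + 1 + 1 := by norm_num
      rw [this, add_mul, add_mul, one_mul]
      gcongr
      · exact le_max_left _ _
      · exact (le_max_left _ _).trans (le_max_right _ _)
      · exact (le_max_right _ _).trans (le_max_right _ _)
    refine (pow_le_pow_left' hm 2).trans ?_
    rw [mul_pow, show (3 : ℝ≥0∞) ^ 2 = 9 by norm_num]
    gcongr
    rcases max_choice a (max b c) with h | h <;> rw [h]
    · rw [add_assoc]; exact le_self_add
    · rcases max_choice b c with h | h <;> rw [h]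
      · rw [add_right_comm]; exact le_add_self
      · exact le_add_self
  have hmeas : ∀ {H : (ℝ × ℝ) × (ℝ × ℝ) → ℝ≥0∞}, Measurable H →
      Measurable fun q => (∫⁻ r, H (q, r) * (f r * g (q - r))) ^ 2 := by
    intro H hH
    refine Measurable.pow_const ?_ 2
    exact Measurable.lintegral_prod_right' (f := fun p : (ℝ × ℝ) × (ℝ × ℝ) =>
      H p * (f p.2 * g (p.1 - p.2))) (by fun_prop)
  calc _ = ∫⁻ q, ((∫⁻ r, κ r (q - r) * (f r * g (q - r))) +
        (∫⁻ r, κ (-q) r * (f r * g (q - r))) +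
        (∫⁻ r, κ (-q) (q - r) * (f r * g (q - r)))) ^ 2 := by
        refine lintegral_congr fun q => ?_
        have m1 := h' (F := fun r => r) (G := fun r => q - r) (by fun_prop) (by fun_prop)
        have m2 := h' (F := fun _ => -q) (G := fun r => r) (by fun_prop) (by fun_prop)
        simp only [pairSum, add_mul]
        rw [lintegral_add_left (by fun_prop), lintegral_add_left (by fun_prop)]
    _ ≤ ∫⁻ q, 9 * ((∫⁻ r, κ r (q - r) * (f r * g (q - r))) ^ 2 +
        (∫⁻ r, κ (-q) r * (f r * g (q - r))) ^ 2 +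
        (∫⁻ r, κ (-q) (q - r) * (f r * g (q - r))) ^ 2) := lintegral_mono fun q => hsq _ _ _
    _ = 9 * ((∫⁻ q, (∫⁻ r, κ r (q - r) * (f r * g (q - r))) ^ 2) +
        (∫⁻ q, (∫⁻ r, κ (-q) r * (f r * g (q - r))) ^ 2) +
        (∫⁻ q, (∫⁻ r, κ (-q) (q - r) * (f r * g (q - r))) ^ 2)) := by
        have n1 := hmeas (h (F := fun p => p.2) (G := fun p => p.1 - p.2) (by fun_prop)
          (by fun_prop))
        have n2 := hmeas (h (F := fun p => -p.1) (G := fun p => p.2) (by fun_prop) (by fun_prop))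
        have n3 := hmeas (h (F := fun p => -p.1) (G := fun p => p.1 - p.2) (by fun_prop)
          (by fun_prop))
        dsimp only at n1 n2 n3
        rw [lintegral_const_mul _ (by fun_prop), lintegral_add_left (by fun_prop),
          lintegral_add_left n1]
    _ ≤ 9 * (C * ((∫⁻ r, f r ^ 2) * ∫⁻ r, g r ^ 2) + C * ((∫⁻ r, g r ^ 2) * ∫⁻ r, f r ^ 2) +
        C * ((∫⁻ r, f r ^ 2) * ∫⁻ r, g r ^ 2)) := by gcongr
    _ = _ := by ring

end Bilinear

/-! ### The bilinear gain for free waves. -/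

section Dispersion

variable {α : ℝ}

theorem hasDerivAt_mul_abs_rpow (hα : 1 < α) (x : ℝ) :
    HasDerivAt (fun x : ℝ => x * |x| ^ α) ((1 + α) * |x| ^ α) x := by
  have h := (hasDerivAt_id x).mul (hasDerivAt_abs_rpow x hα)
  refine h.congr_deriv ?_
  simp only [id]
  have : x * (α * |x| ^ (α - 2) * x) = α * |x| ^ α := by
    rcases eq_or_ne x 0 with rfl | hx
    · simp [Real.zero_rpow (by linarith : α ≠ 0)]
    · have hx' : 0 < |x| := abs_pos.2 hx
      have h2 : |x| ^ α = |x| ^ (α - 2) * |x| ^ 2 := by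
        rw [← Real.rpow_natCast, ← Real.rpow_add hx']; norm_num
      rw [h2, sq_abs]; ring
  rw [this]; ring

theorem hasDerivAt_phase (hα : 1 < α) (ξ x : ℝ) :
    HasDerivAt (fun x => x * |x| ^ α + (ξ - x) * |ξ - x| ^ α)
      ((1 + α) * (|x| ^ α - |ξ - x| ^ α)) x := by
  have h1 := hasDerivAt_mul_abs_rpow hα x
  have h2 := (hasDerivAt_mul_abs_rpow hα (ξ - x)).comp x ((hasDerivAt_id x).const_sub ξ)
  refine (h1.add h2).congr_deriv ?_
  ring

/-- Along a monotone branch of the phase, the derivative is a change of variables. -/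
theorem setLIntegral_abs_deriv_mul_comp_le {h h' : ℝ → ℝ} {s : Set ℝ} (hs : MeasurableSet s)
    (hd : ∀ x, HasDerivAt h (h' x) x) (hi : Set.InjOn h s) (G : ℝ → ℝ≥0∞) :
    ∫⁻ x in s, ENNReal.ofReal |h' x| * G (h x) ≤ ∫⁻ y, G y := by
  rw [← lintegral_image_eq_lintegral_abs_deriv_mul hs (fun x _ => (hd x).hasDerivWithinAt) hi]
  exact setLIntegral_le_lintegral _ _

theorem abs_rpow_sub_pos_iff (hα : 0 < α) {x y : ℝ} : 0 < |x| ^ α - |y| ^ α ↔ |y| < |x| := by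
  rw [sub_pos, Real.rpow_lt_rpow_iff (abs_nonneg _) (abs_nonneg _) hα]

/-- The phase `x ↦ x|x|^α + (ξ - x)|ξ - x|^α` is monotone on both sides of `ξ / 2`. -/
theorem injOn_phase (hα : 1 < α) {ξ : ℝ} (hξ : ξ ≠ 0) :
    Set.InjOn (fun x => x * |x| ^ α + (ξ - x) * |ξ - x| ^ α) (Set.Iic (ξ / 2)) ∧
    Set.InjOn (fun x => x * |x| ^ α + (ξ - x) * |ξ - x| ^ α) (Set.Ici (ξ / 2)) := by
  have hd := hasDerivAt_phase hα ξ
  have hc : Continuous fun x => x * |x| ^ α + (ξ - x) * |ξ - x| ^ α :=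
    continuous_iff_continuousAt.2 fun x => (hd x).continuousAt
  have hpos : ∀ x, 0 < ξ * (2 * x - ξ) → 0 < (1 + α) * (|x| ^ α - |ξ - x| ^ α) := by
    intro x hx
    refine mul_pos (by linarith) ((abs_rpow_sub_pos_iff (by linarith)).2 (sq_lt_sq.1 ?_))
    nlinarith
  have hneg : ∀ x, ξ * (2 * x - ξ) < 0 → (1 + α) * (|x| ^ α - |ξ - x| ^ α) < 0 := by
    intro x hx
    have := (abs_rpow_sub_pos_iff (α := α) (by linarith)).2 (sq_lt_sq.1
      (show x ^ 2 < (ξ - x) ^ 2 by nlinarith))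
    nlinarith
  rcases lt_or_gt_of_ne hξ with h | h
  · refine ⟨(strictMonoOn_of_deriv_pos (convex_Iic _) hc.continuousOn fun x hx => ?_).injOn,
      (strictAntiOn_of_deriv_neg (convex_Ici _) hc.continuousOn fun x hx => ?_).injOn⟩
    · rw [interior_Iic, Set.mem_Iio] at hx
      rw [(hd x).deriv]; exact hpos x (by nlinarith)
    · rw [interior_Ici, Set.mem_Ioi] at hx
      rw [(hd x).deriv]; exact hneg x (by nlinarith)
  · refine ⟨(strictAntiOn_of_deriv_neg (convex_Iic _) hc.continuousOn fun x hx => ?_).injOn,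
      (strictMonoOn_of_deriv_pos (convex_Ici _) hc.continuousOn fun x hx => ?_).injOn⟩
    · rw [interior_Iic, Set.mem_Iio] at hx
      rw [(hd x).deriv]; exact hneg x (by nlinarith)
    · rw [interior_Ici, Set.mem_Ioi] at hx
      rw [(hd x).deriv]; exact hpos x (by nlinarith)

/-- Up to the factor `1 + α` the weight is the derivative of the phase; each of the two monotone
branches contributes one copy of `∫ G`. For `ξ = 0` the weight vanishes. -/
theorem lintegral_transversal_mul_le (hα : 1 < α) (ξ : ℝ) (G : ℝ → ℝ≥0∞) :
    ∫⁻ x, ENNReal.ofReal |(|x| ^ α - |ξ - x| ^ α)| *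
      G (x * |x| ^ α + (ξ - x) * |ξ - x| ^ α) ≤ 2 * ∫⁻ y, G y := by
  rcases eq_or_ne ξ 0 with rfl | hξ
  · simp
  have hd := hasDerivAt_phase hα ξ
  have hle : ∀ x, ENNReal.ofReal |(|x| ^ α - |ξ - x| ^ α)| *
      G (x * |x| ^ α + (ξ - x) * |ξ - x| ^ α) ≤
      ENNReal.ofReal |(1 + α) * (|x| ^ α - |ξ - x| ^ α)| *
      G (x * |x| ^ α + (ξ - x) * |ξ - x| ^ α) := by
    intro x
    refine mul_le_mul_left (ENNReal.ofReal_le_ofReal ?_) _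
    rw [abs_mul, abs_of_pos (by linarith : 0 < 1 + α)]
    exact le_mul_of_one_le_left (abs_nonneg _) (by linarith)
  obtain ⟨hi1, hi2⟩ := injOn_phase hα hξ
  calc _ ≤ _ := lintegral_mono hle
    _ = _ := (lintegral_add_compl _ (measurableSet_Iic (a := ξ / 2))).symm
    _ ≤ (∫⁻ y, G y) + ∫⁻ y, G y := by
        refine add_le_add (setLIntegral_abs_deriv_mul_comp_le measurableSet_Iic hd hi1 G)
          (setLIntegral_abs_deriv_mul_comp_le measurableSet_Iic.compl hd (hi2.mono ?_) G)
        rw [Set.compl_Iic]; exact Set.Ioi_subset_Ici_self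
    _ = _ := (two_mul _).symm

/-- The gain of the bilinear estimate for two waves of frequencies `ξ` and `η`: transversality,
the almost parallel interaction, and low frequencies. -/
noncomputable def bilinearGain (α ξ η : ℝ) : ℝ :=
  |(|ξ| ^ α - |η| ^ α)| +
    (if |ξ - η| ≤ |ξ + η| ^ (-((α - 1) / 2)) then |ξ + η| ^ ((α - 1) / 2) else 0) +
    (if |ξ| ≤ 2 ∧ |η| ≤ 2 then 1 else 0)

theorem bilinearGain_nonneg (α ξ η : ℝ) : 0 ≤ bilinearGain α ξ η := by
  unfold bilinearGain
  have : 0 ≤ |ξ + η| ^ ((α - 1) / 2) := by positivity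
  split_ifs <;> positivity

theorem measurable_bilinearGain (α : ℝ) :
    Measurable fun p : ℝ × ℝ => bilinearGain α p.1 p.2 := by
  unfold bilinearGain
  refine ((by fun_prop : Measurable _).add (Measurable.ite ?_ (by fun_prop) (by fun_prop))).add
    (Measurable.ite ?_ (by fun_prop) (by fun_prop))
  · exact measurableSet_le (by fun_prop) (by fun_prop)
  · exact (measurableSet_le (f := fun p : ℝ × ℝ => |p.1|) (by fun_prop) measurable_const).inter
      (measurableSet_le (f := fun p : ℝ × ℝ => |p.2|) (by fun_prop) measurable_const)

/-- The kernel of the bilinear estimate for the solutions of the linear equation. -/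
noncomputable def bilinearKernel (α b : ℝ) (p q : ℝ × ℝ) : ℝ :=
  Real.sqrt (bilinearGain α p.2 q.2) * (jbracket (p.1 - p.2 * |p.2| ^ α) ^ (-b) *
    jbracket (q.1 - q.2 * |q.2| ^ α) ^ (-b))

theorem bilinearKernel_nonneg (α b : ℝ) (p q : ℝ × ℝ) : 0 ≤ bilinearKernel α b p q := by
  have h := fun x => (Real.rpow_pos_of_pos (jbracket_pos x) (-b)).le
  exact mul_nonneg (Real.sqrt_nonneg _) (mul_nonneg (h _) (h _))

theorem measurable_bilinearKernel (α b : ℝ) :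
    Measurable (Function.uncurry fun p q => ENNReal.ofReal (bilinearKernel α b p q)) := by
  unfold bilinearKernel Function.uncurry
  have := (measurable_bilinearGain α).comp
    (f := fun p : (ℝ × ℝ) × (ℝ × ℝ) => (p.1.2, p.2.2)) (by fun_prop)
  simp only [Function.comp_def] at this
  fun_prop

/-- The transversal part is a change of variables. The almost parallel part lives on an interval
whose length `|ξ|^{-(α-1)/2}` is the reciprocal of its height, so it contributes at most `1`; the
low part contributes at most the length `4` of `[-2, 2]`. -/
theorem lintegral_bilinearGain_mul_le (hα : 1 < α) (ξ : ℝ) {G : ℝ → ℝ≥0∞}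
    (hG1 : ∀ y, G y ≤ 1) :
    ∫⁻ x, ENNReal.ofReal (bilinearGain α x (ξ - x)) *
      G (x * |x| ^ α + (ξ - x) * |ξ - x| ^ α) ≤ 2 * (∫⁻ y, G y) + 5 := by
  set S : Set ℝ := Set.Icc ((ξ - |ξ| ^ (-((α - 1) / 2))) / 2) ((ξ + |ξ| ^ (-((α - 1) / 2))) / 2)
  set T : Set ℝ := Set.Icc (-2) 2
  have hb : ∀ x, ENNReal.ofReal (bilinearGain α x (ξ - x)) *
      G (x * |x| ^ α + (ξ - x) * |ξ - x| ^ α) ≤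
      ENNReal.ofReal |(|x| ^ α - |ξ - x| ^ α)| * G (x * |x| ^ α + (ξ - x) * |ξ - x| ^ α) +
      (S.indicator (fun _ => ENNReal.ofReal (|ξ| ^ ((α - 1) / 2))) x + T.indicator 1 x) := by
    intro x
    have hS : ENNReal.ofReal (if |x - (ξ - x)| ≤ |x + (ξ - x)| ^ (-((α - 1) / 2)) then
        |x + (ξ - x)| ^ ((α - 1) / 2) else 0) =
        S.indicator (fun _ => ENNReal.ofReal (|ξ| ^ ((α - 1) / 2))) x := by
      rw [add_sub_cancel]
      by_cases h : |x - (ξ - x)| ≤ |ξ| ^ (-((α - 1) / 2))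
      · have hx : x ∈ S := by rw [abs_le] at h; constructor <;> linarith
        rw [if_pos h, Set.indicator_of_mem hx]
      · have hx : x ∉ S := fun hx => h (by rw [abs_le]; constructor <;> linarith [hx.1, hx.2])
        rw [if_neg h, Set.indicator_of_notMem hx, ENNReal.ofReal_zero]
    have hT : ENNReal.ofReal (if |x| ≤ 2 ∧ |ξ - x| ≤ 2 then 1 else 0) ≤ T.indicator 1 x := by
      by_cases h : |x| ≤ 2 ∧ |ξ - x| ≤ 2
      · rw [if_pos h, Set.indicator_of_mem (show x ∈ T from abs_le.1 h.1)]; simp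
      · rw [if_neg h, ENNReal.ofReal_zero]; exact zero_le
    have h0 : 0 ≤ (if |x - (ξ - x)| ≤ |x + (ξ - x)| ^ (-((α - 1) / 2)) then
        |x + (ξ - x)| ^ ((α - 1) / 2) else 0) := by
      split_ifs <;> positivity
    rw [bilinearGain, ENNReal.ofReal_add (by positivity) (by split_ifs <;> norm_num),
      ENNReal.ofReal_add (by positivity) h0, hS, add_assoc, add_mul]
    gcongr
    exact (mul_le_of_le_one_right' (hG1 _)).trans (by gcongr)
  refine (lintegral_mono hb).trans ?_
  have hmS : MeasurableSet S := measurableSet_Icc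
  have hmT : MeasurableSet T := measurableSet_Icc
  have hm1 : Measurable (S.indicator fun _ => ENNReal.ofReal (|ξ| ^ ((α - 1) / 2))) :=
    measurable_const.indicator hmS
  have hm2 : Measurable (T.indicator (1 : ℝ → ℝ≥0∞)) := measurable_one.indicator hmT
  rw [lintegral_add_right _ (by fun_prop), lintegral_add_right _ hm2,
    lintegral_indicator_const hmS,
    lintegral_indicator_one hmT]
  refine add_le_add (lintegral_transversal_mul_le hα ξ G) ?_
  have hT : volume T = 4 := by
    rw [Real.volume_Icc]; norm_num
  have hS : ENNReal.ofReal (|ξ| ^ ((α - 1) / 2)) * volume S ≤ 1 := by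
    rw [Real.volume_Icc, ← ENNReal.ofReal_mul (by positivity), ENNReal.ofReal_le_one]
    rcases eq_or_ne ξ 0 with rfl | hξ
    · rw [abs_zero, Real.zero_rpow (by linarith)]; simp
    · have hξ' : 0 < |ξ| := abs_pos.2 hξ
      rw [Real.rpow_neg hξ'.le]
      have : 0 < |ξ| ^ ((α - 1) / 2) := by positivity
      field_simp
      linarith
  rw [hT]
  calc _ ≤ (1 : ℝ≥0∞) + 4 := by gcongr
    _ = 5 := by norm_num

/-- The bilinear estimate for solutions of the linear equation, in the form of Schur's test. -/
theorem exists_lintegral_bilinearKernel_sq_le (hα : 1 < α) {b : ℝ} (hb : 1 / 2 < b) :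
    ∃ C : ℝ≥0, ∀ q : ℝ × ℝ,
      ∫⁻ r, ENNReal.ofReal (bilinearKernel α b r (q - r)) ^ 2 ≤ C := by
  set B : ℝ → ℝ≥0∞ := fun y => ENNReal.ofReal (jbracket y ^ (-(2 * b)))
  have hBm : Measurable B := by fun_prop
  have hB : ∫⁻ y, B y < ∞ := lintegral_jbracket_rpow_neg_lt_top (by linarith)
  set M : ℝ≥0∞ := ENNReal.ofReal (2 ^ (2 * b)) * (2 * ∫⁻ y, B y)
  have hM : M < ∞ := ENNReal.mul_lt_top ENNReal.ofReal_lt_top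
    (ENNReal.mul_lt_top (by norm_num) hB)
  have hK : M * (2 * (∫⁻ y, B y) + 5) < ∞ := ENNReal.mul_lt_top hM
    (ENNReal.add_lt_top.2 ⟨ENNReal.mul_lt_top (by norm_num) hB, by norm_num⟩)
  refine ⟨(M * (2 * (∫⁻ y, B y) + 5)).toNNReal, fun q => ?_⟩
  rw [ENNReal.coe_toNNReal hK.ne]
  have hsq : ∀ y, ENNReal.ofReal (jbracket y ^ (-b)) ^ 2 = B y := by
    intro y
    have h := (Real.rpow_pos_of_pos (jbracket_pos y) (-b)).le
    rw [← ENNReal.ofReal_pow h, ← Real.rpow_natCast, ← Real.rpow_mul (jbracket_pos y).le]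
    simp only [B]
    congr 2; push_cast; ring
  have hk : ∀ r, ENNReal.ofReal (bilinearKernel α b r (q - r)) ^ 2 =
      ENNReal.ofReal (bilinearGain α r.2 (q.2 - r.2)) * (B (r.1 - r.2 * |r.2| ^ α) *
        B (q.1 - (q.2 - r.2) * |q.2 - r.2| ^ α - r.1)) := by
    intro r
    have h := fun y => (Real.rpow_pos_of_pos (jbracket_pos y) (-b)).le
    rw [bilinearKernel, ENNReal.ofReal_mul (Real.sqrt_nonneg _), ENNReal.ofReal_mul (h _),
      mul_pow, mul_pow, hsq, hsq, ← ENNReal.ofReal_pow (Real.sqrt_nonneg _),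
      Real.sq_sqrt (bilinearGain_nonneg _ _ _)]
    congr 3
    simp only [Prod.fst_sub, Prod.snd_sub]; ring
  have hgm := (measurable_bilinearGain α).comp
    (f := fun r : ℝ × ℝ => (r.2, q.2 - r.2)) (by fun_prop)
  simp only [Function.comp_def] at hgm
  have hgm' := (measurable_bilinearGain α).comp
    (f := fun x : ℝ => (x, q.2 - x)) (by fun_prop)
  simp only [Function.comp_def] at hgm'
  simp only [hk]
  -- The time frequency is integrated first: the two modulation weights convolve into one, evaluated
  -- at `q.1` minus the phase.
  rw [Measure.volume_eq_prod, lintegral_prod_symm _ (by fun_prop)]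
  calc _ ≤ ∫⁻ x, M * (ENNReal.ofReal (bilinearGain α x (q.2 - x)) *
        B (q.1 - (x * |x| ^ α + (q.2 - x) * |q.2 - x| ^ α))) := by
        refine lintegral_mono fun x => ?_
        dsimp only
        rw [lintegral_const_mul _ (by fun_prop)]
        have h := lintegral_jbracket_mul_le (β := 2 * b) (by linarith) (x * |x| ^ α)
          (q.1 - (q.2 - x) * |q.2 - x| ^ α)
        rw [show q.1 - (q.2 - x) * |q.2 - x| ^ α - x * |x| ^ α =
          q.1 - (x * |x| ^ α + (q.2 - x) * |q.2 - x| ^ α) by ring] at h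
        calc _ ≤ ENNReal.ofReal (bilinearGain α x (q.2 - x)) * (M *
              B (q.1 - (x * |x| ^ α + (q.2 - x) * |q.2 - x| ^ α))) := by gcongr
          _ = _ := by ring
    _ = M * ∫⁻ x, (ENNReal.ofReal (bilinearGain α x (q.2 - x)) *
        B (q.1 - (x * |x| ^ α + (q.2 - x) * |q.2 - x| ^ α))) :=
        lintegral_const_mul _ (by fun_prop)
    _ ≤ _ := by
        gcongr
        have h := lintegral_bilinearGain_mul_le hα q.2 (G := fun y => B (q.1 - y))
          (fun y => ENNReal.ofReal_le_one.2 (jbracket_rpow_neg_le_one (by linarith) _))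
        rwa [lintegral_sub_left_eq_self B q.1] at h

end Dispersion

/-! ### Exponent arithmetic in logarithmic variables: `n` for the high frequency, `M` for the
largest modulation. -/

section Exponents

/-- The parameters of the estimate: `p = -s₀`, and `ε` measures the distance to the endpoint. -/
structure ExponentData (α ω p ε : ℝ) : Prop where
  one_lt : 1 < α
  lt_two : α < 2
  mul_eq : α * ω = 1 - α / 2
  omega_nonneg : 0 ≤ ω
  omega_le : ω ≤ 1 / 2
  p_nonneg : 0 ≤ p
  eps_pos : 0 < ε
  p_le : p + 12 * ε ≤ 3 / 4 * (α - 1)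

/-- The logarithm of the quotient of the weights without the modulation factors. -/
def logSymbol (α ω p : ℝ) (x₀ x₁ x₂ j₀ j₁ j₂ l₀ l₁ l₂ : ℝ) : ℝ :=
  (1 - ω) * x₀ - (p + α * ω) * j₀ + ω * l₀ + (ω * x₁ + (p + α * ω) * j₁ - ω * l₁) +
    (ω * x₂ + (p + α * ω) * j₂ - ω * l₂)

variable {α ω p ε x₀ x₁ x₂ j₀ j₁ j₂ l₀ l₁ l₂ n M : ℝ}

/-- Even after the output weight is estimated by `ω * M`, the total power of the largest modulation
stays nonpositive, so lower bounds on `M` can be inserted. -/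
theorem ExponentData.omega_add_le (h : ExponentData α ω p ε) : ω + (-1 / 2 + 2 * ε) ≤ 0 := by
  have h1 := h.one_lt; have h2 := h.lt_two; have h3 := h.mul_eq
  have h4 := h.p_nonneg; have h5 := h.p_le; have h6 := h.eps_pos
  nlinarith

theorem ExponentData.p_le_one (h : ExponentData α ω p ε) : p ≤ 1 := by
  linarith [h.p_le, h.lt_two, h.eps_pos]

theorem logSymbol_le_of_low (h : ExponentData α ω p ε) (hx₀ : x₀ ≤ 2) (hx₁ : x₁ ≤ 1)
    (hx₂ : x₂ ≤ 1) (hj₀ : 0 ≤ j₀) (hj₁ : j₁ ≤ 2) (hj₂ : j₂ ≤ 2)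
    (hl₁ : 0 ≤ l₁) (hl₂ : 0 ≤ l₂) (hl : l₀ ≤ max l₁ l₂ + 4) :
    logSymbol α ω p x₀ x₁ x₂ j₀ j₁ j₂ l₀ l₁ l₂ ≤ 40 := by
  have hω := h.omega_nonneg
  have hω' := h.omega_le
  have hp := h.p_nonneg
  have hp' := h.p_le_one
  have hm := h.mul_eq
  have hα := h.one_lt
  have hα2 := h.lt_two
  have hl' : l₀ ≤ l₁ + l₂ + 4 := hl.trans (by
    gcongr; exact max_le (by linarith) (by linarith))
  unfold logSymbol
  have e1 := mul_nonneg hω (sub_nonneg.2 hl')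
  have e2 := mul_nonneg (sub_nonneg.2 hω') (sub_nonneg.2 hx₀)
  have e3 := mul_nonneg hω (sub_nonneg.2 hx₁)
  have e4 := mul_nonneg hω (sub_nonneg.2 hx₂)
  have hq : 0 ≤ p + α * ω := by rw [hm]; linarith
  have e5 := mul_nonneg hq (sub_nonneg.2 hj₁)
  have e6 := mul_nonneg hq (sub_nonneg.2 hj₂)
  have e7 := mul_nonneg hq hj₀
  nlinarith

/-- With `l₀` bounded by `M`, the main terms reduce to `x₀ / 2 + (2p + 1 - α) n`. This is within the
gain when `2p ≤ 3(α-1)/2`; the reserve of `12ε` in `p_le` covers the `ε` losses. -/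
theorem logSymbol_le_of_low_output (h : ExponentData α ω p ε) (hn : 0 ≤ n) (hx₀ : x₀ ≤ n)
    (hx₁ : x₁ ≤ n) (hx₂ : x₂ ≤ n) (hj₀ : 0 ≤ j₀) (hj₁ : j₁ ≤ n + 1) (hj₂ : j₂ ≤ n + 1)
    (hl₁ : (1 + α) * n ≤ l₁ + 5) (hl₂ : (1 + α) * n ≤ l₂ + 5) (hl₀ : l₀ ≤ M + 6)
    (hM : x₀ + α * n ≤ M + 2) :
    logSymbol α ω p x₀ x₁ x₂ j₀ j₁ j₂ l₀ l₁ l₂ + (-1 / 2 + 2 * ε) * M ≤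
      (x₀ + (α - 1) * n) / 2 + 40 := by
  have hω := h.omega_nonneg
  have hω' := h.omega_le
  have hp := h.p_nonneg
  have hp' := h.p_le_one
  have hm := h.mul_eq
  have hα := h.one_lt
  have hα2 := h.lt_two
  have hb := h.omega_add_le
  have hε := h.eps_pos
  have hpe := h.p_le
  unfold logSymbol
  have hq : 0 ≤ p + α * ω := by rw [hm]; linarith
  have e1 := mul_nonneg hω (sub_nonneg.2 hl₀)
  have e2 := mul_nonneg hω (sub_nonneg.2 hl₁)
  have e3 := mul_nonneg hω (sub_nonneg.2 hl₂)
  have e4 := mul_nonneg (neg_nonneg.2 hb) (sub_nonneg.2 hM)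
  have e5 := mul_nonneg hq (sub_nonneg.2 hj₁)
  have e6 := mul_nonneg hq (sub_nonneg.2 hj₂)
  have e7 := mul_nonneg hq hj₀
  have e8 := mul_nonneg hω (sub_nonneg.2 hx₁)
  have e9 := mul_nonneg hω (sub_nonneg.2 hx₂)
  have e10 := mul_nonneg hε.le (sub_nonneg.2 hx₀)
  have e11 := mul_nonneg (mul_nonneg hε.le hn) (sub_nonneg.2 hα2.le)
  have e12 := mul_nonneg hn (sub_nonneg.2 hpe)
  have e13 := mul_nonneg hε.le hn
  have e14 : α * ω * n = (1 - α / 2) * n := by rw [hm]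
  linarith

/-- The main terms are `(1 + p) n - (1 + α) n / 2`, and comparison with `(α - 1) n / 4` is again the
condition `p ≤ 3(α-1)/4`. -/
theorem logSymbol_le_of_comparable (h : ExponentData α ω p ε) (hn : 0 ≤ n) (hx₀ : x₀ ≤ n + 1)
    (hx₁ : x₁ ≤ n) (hx₂ : x₂ ≤ n) (hj₀ : n ≤ j₀ + 2) (hj₁ : j₁ ≤ n + 1) (hj₂ : j₂ ≤ n + 1)
    (hl₁ : (1 + α) * n ≤ l₁ + 9) (hl₂ : (1 + α) * n ≤ l₂ + 9) (hl : l₀ ≤ max l₁ l₂ + 4)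
    (hM : (1 + α) * n ≤ M + 4) :
    logSymbol α ω p x₀ x₁ x₂ j₀ j₁ j₂ l₀ l₁ l₂ + (-1 / 2 + 2 * ε) * M ≤
      ((α - 1) / 2 * n) / 2 + 40 := by
  have hω := h.omega_nonneg
  have hω' := h.omega_le
  have hp := h.p_nonneg
  have hp' := h.p_le_one
  have hm := h.mul_eq
  have hα := h.one_lt
  have hα2 := h.lt_two
  have hb := h.omega_add_le
  have hε := h.eps_pos
  have hpe := h.p_le
  have hl' : l₀ + (1 + α) * n ≤ l₁ + l₂ + 13 := by
    rcases max_choice l₁ l₂ with h | h <;> rw [h] at hl <;> linarith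
  unfold logSymbol
  have hq : 0 ≤ p + α * ω := by rw [hm]; linarith
  have e1 := mul_nonneg hω (sub_nonneg.2 hl')
  have e4 := mul_nonneg (show 0 ≤ -(-1 / 2 + 2 * ε) by linarith) (sub_nonneg.2 hM)
  have e5 := mul_nonneg hq (sub_nonneg.2 hj₁)
  have e6 := mul_nonneg hq (sub_nonneg.2 hj₂)
  have e7 := mul_nonneg hq (sub_nonneg.2 hj₀)
  have e8 := mul_nonneg hω (sub_nonneg.2 hx₁)
  have e9 := mul_nonneg hω (sub_nonneg.2 hx₂)
  have e10 := mul_nonneg (show 0 ≤ 1 - ω by linarith) (sub_nonneg.2 hx₀)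
  have e11 := mul_nonneg (mul_nonneg hε.le hn) (sub_nonneg.2 hα2.le)
  have e12 := mul_nonneg hn (sub_nonneg.2 hpe)
  have e13 := mul_nonneg hε.le hn
  have e14 : α * ω * n = (1 - α / 2) * n := by rw [hm]
  linarith

/-- Only the part `-ω * M` of the modulation decay is used: it cancels `ω * x₂`, which may be very
negative, and leaves `n - αω n = α n / 2` with no room to spare. -/
theorem logSymbol_le_of_low_input (h : ExponentData α ω p ε) (hx₀ : x₀ ≤ n + 1)
    (hx₁ : x₁ ≤ n) (hj₀ : n ≤ j₀ + 1) (hj₁ : j₁ ≤ n + 1) (hj₂ : j₂ ≤ 1)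
    (hl₁ : 0 ≤ l₁) (hl₂ : 0 ≤ l₂) (hl : l₀ ≤ max l₁ l₂ + 4) (hM0 : 0 ≤ M)
    (hM : x₂ + α * n ≤ M + 2) :
    logSymbol α ω p x₀ x₁ x₂ j₀ j₁ j₂ l₀ l₁ l₂ + (-1 / 2 + 2 * ε) * M ≤
      (α * n) / 2 + 40 := by
  have hω := h.omega_nonneg
  have hω' := h.omega_le
  have hp := h.p_nonneg
  have hp' := h.p_le_one
  have hm := h.mul_eq
  have hα := h.one_lt
  have hα2 := h.lt_two
  have hb := h.omega_add_le
  have hl' : l₀ ≤ l₁ + l₂ + 4 := by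
    rcases max_choice l₁ l₂ with h | h <;> rw [h] at hl <;> linarith
  unfold logSymbol
  have hq : 0 ≤ p + α * ω := by rw [hm]; linarith
  have e1 := mul_nonneg hω (sub_nonneg.2 hl')
  have e4 := mul_nonneg hω (sub_nonneg.2 hM)
  have e41 := mul_nonneg (neg_nonneg.2 hb) hM0
  have e5 := mul_nonneg hq (sub_nonneg.2 hj₁)
  have e6 := mul_nonneg hq (sub_nonneg.2 hj₂)
  have e7 := mul_nonneg hq (sub_nonneg.2 hj₀)
  have e8 := mul_nonneg hω (sub_nonneg.2 hx₁)
  have e10 := mul_nonneg (show 0 ≤ 1 - ω by linarith) (sub_nonneg.2 hx₀)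
  have e14 : α * ω * n = (1 - α / 2) * n := by rw [hm]
  linarith

/-- For use when the low input has the largest modulation: the factor `ω * l₂` of its own weight
replaces the decay in `M`. -/
theorem logSymbol_le_of_low_input_max (h : ExponentData α ω p ε) (hx₀ : x₀ ≤ n + 1)
    (hx₁ : x₁ ≤ n) (hj₀ : n ≤ j₀ + 1) (hj₁ : j₁ ≤ n + 1) (hj₂ : j₂ ≤ 1)
    (hl₁ : x₂ + α * n ≤ l₁ + 5) (hl₂ : x₂ + α * n ≤ l₂ + 5) (hl : l₀ ≤ max l₁ l₂ + 4) :
    logSymbol α ω p x₀ x₁ x₂ j₀ j₁ j₂ l₀ l₁ l₂ ≤ (α * n) / 2 + 40 := by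
  have hω := h.omega_nonneg
  have hω' := h.omega_le
  have hp := h.p_nonneg
  have hp' := h.p_le_one
  have hm := h.mul_eq
  have hα := h.one_lt
  have hα2 := h.lt_two
  have hl' : l₀ + (x₂ + α * n) ≤ l₁ + l₂ + 9 := by
    rcases max_choice l₁ l₂ with h | h <;> rw [h] at hl <;> linarith
  unfold logSymbol
  have hq : 0 ≤ p + α * ω := by rw [hm]; linarith
  have e1 := mul_nonneg hω (sub_nonneg.2 hl')
  have e5 := mul_nonneg hq (sub_nonneg.2 hj₁)
  have e6 := mul_nonneg hq (sub_nonneg.2 hj₂)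
  have e7 := mul_nonneg hq (sub_nonneg.2 hj₀)
  have e8 := mul_nonneg hω (sub_nonneg.2 hx₁)
  have e10 := mul_nonneg (show 0 ≤ 1 - ω by linarith) (sub_nonneg.2 hx₀)
  have e14 : α * ω * n = (1 - α / 2) * n := by rw [hm]
  linarith

theorem logSymbol_le_of_medium_input (h : ExponentData α ω p ε) (hn : 0 ≤ n) (hx₀ : x₀ ≤ n + 1)
    (hx₁ : x₁ ≤ n) (hx₂ : 0 ≤ x₂) (hx₂' : x₂ ≤ n) (hj₀ : n ≤ j₀ + 1) (hj₁ : j₁ ≤ n + 1)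
    (hj₂ : j₂ ≤ x₂ + 1) (hl₁ : (1 + α) * n ≤ l₁ + 5) (hl₂ : (1 + α) * x₂ ≤ l₂ + 5)
    (hl : l₀ ≤ max l₁ l₂ + 4) (hM : x₂ + α * n ≤ M + 2) :
    logSymbol α ω p x₀ x₁ x₂ j₀ j₁ j₂ l₀ l₁ l₂ + (-1 / 2 + 2 * ε) * M ≤
      (α * n) / 2 + 40 := by
  have hω := h.omega_nonneg
  have hω' := h.omega_le
  have hp := h.p_nonneg
  have hp' := h.p_le_one
  have hm := h.mul_eq
  have hα := h.one_lt
  have hα2 := h.lt_two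
  have hb := h.omega_add_le
  have hε := h.eps_pos
  have hpe := h.p_le
  have hl₁' : (1 + α) * x₂ ≤ l₁ + 5 :=
    (mul_le_mul_of_nonneg_left hx₂' (by linarith)).trans hl₁
  have hl' : l₀ + (1 + α) * x₂ ≤ l₁ + l₂ + 9 := by
    rcases max_choice l₁ l₂ with h | h <;> rw [h] at hl <;> linarith
  unfold logSymbol
  have hq : 0 ≤ p + α * ω := by rw [hm]; linarith
  have e1 := mul_nonneg hω (sub_nonneg.2 hl')
  have e4 := mul_nonneg (show 0 ≤ -(-1 / 2 + 2 * ε) by linarith) (sub_nonneg.2 hM)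
  have e5 := mul_nonneg hq (sub_nonneg.2 hj₁)
  have e6 := mul_nonneg hq (sub_nonneg.2 hj₂)
  have e7 := mul_nonneg hq (sub_nonneg.2 hj₀)
  have e8 := mul_nonneg hω (sub_nonneg.2 hx₁)
  have e10 := mul_nonneg (show 0 ≤ 1 - ω by linarith) (sub_nonneg.2 hx₀)
  have e11 := mul_nonneg (mul_nonneg hε.le hn) (sub_nonneg.2 hα2.le)
  have e12 := mul_nonneg hn (sub_nonneg.2 hpe)
  have e13 := mul_nonneg hε.le hn
  have e14 : α * ω * n = (1 - α / 2) * n := by rw [hm]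
  have e15 : α * ω * x₂ = (1 - α / 2) * x₂ := by rw [hm]
  have e16 := mul_nonneg (show 0 ≤ p + 2 * ε by linarith) (sub_nonneg.2 hx₂')
  have e17 := mul_nonneg hn (show 0 ≤ α - 1 by linarith)
  linarith

/-- Here the decay in `M` and the input weights both see the resonance, which makes up for a gain of
only `x₂ + (α - 1) n` instead of `α n`. -/
theorem logSymbol_le_of_medium_input_max (h : ExponentData α ω p ε) (hn : 0 ≤ n)
    (hx₀ : x₀ ≤ n + 1) (hx₁ : x₁ ≤ n) (hx₂ : 0 ≤ x₂) (hj₀ : n ≤ j₀ + 1)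
    (hj₁ : j₁ ≤ n + 1) (hj₂ : j₂ ≤ x₂ + 1) (hl₁ : x₂ + α * n ≤ l₁ + 5)
    (hl₂ : x₂ + α * n ≤ l₂ + 5) (hl : l₀ ≤ max l₁ l₂ + 4) (hM : x₂ + α * n ≤ M + 2) :
    logSymbol α ω p x₀ x₁ x₂ j₀ j₁ j₂ l₀ l₁ l₂ + (-1 / 2 + 2 * ε) * M ≤
      (x₂ + (α - 1) * n) / 2 + 40 := by
  have hω := h.omega_nonneg
  have hω' := h.omega_le
  have hp := h.p_nonneg
  have hp' := h.p_le_one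
  have hm := h.mul_eq
  have hα := h.one_lt
  have hα2 := h.lt_two
  have hb := h.omega_add_le
  have hε := h.eps_pos
  have hpe := h.p_le
  have hl' : l₀ + (x₂ + α * n) ≤ l₁ + l₂ + 9 := by
    rcases max_choice l₁ l₂ with h | h <;> rw [h] at hl <;> linarith
  unfold logSymbol
  have hq : 0 ≤ p + α * ω := by rw [hm]; linarith
  have e1 := mul_nonneg hω (sub_nonneg.2 hl')
  have e4 := mul_nonneg (show 0 ≤ -(-1 / 2 + 2 * ε) by linarith) (sub_nonneg.2 hM)
  have e5 := mul_nonneg hq (sub_nonneg.2 hj₁)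
  have e6 := mul_nonneg hq (sub_nonneg.2 hj₂)
  have e7 := mul_nonneg hq (sub_nonneg.2 hj₀)
  have e8 := mul_nonneg hω (sub_nonneg.2 hx₁)
  have e10 := mul_nonneg (show 0 ≤ 1 - ω by linarith) (sub_nonneg.2 hx₀)
  have e11 := mul_nonneg (mul_nonneg hε.le hn) (sub_nonneg.2 hα2.le)
  have e14 : α * ω * n = (1 - α / 2) * n := by rw [hm]
  have e15 : α * ω * x₂ = (1 - α / 2) * x₂ := by rw [hm]
  have e16 := mul_nonneg (show 0 ≤ α / 2 - p - 2 * ε by linarith) hx₂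
  have e17 := mul_nonneg hn (show 0 ≤ (α - 1) / 2 - 4 * ε by linarith)
  linarith

end Exponents

/-! ### Lower bounds for the resonance function and for the bilinear gain. -/

section Resonance

variable {α : ℝ}

theorem rpow_sub_one_mul_sub_le (hα : 1 < α) {u v : ℝ} (hv : 0 ≤ v) (h : v ≤ u) :
    u ^ (α - 1) * (u - v) ≤ u ^ α - v ^ α := by
  have hu : 0 ≤ u := hv.trans h
  have split : ∀ {y : ℝ}, 0 ≤ y → y ^ α = y ^ (α - 1) * y := by
    intro y hy
    rcases hy.eq_or_lt with rfl | hy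
    · rw [mul_zero, Real.zero_rpow (by linarith)]
    · rw [← Real.rpow_add_one hy.ne']; congr 1; ring
  have hle : v ^ (α - 1) ≤ u ^ (α - 1) := Real.rpow_le_rpow hv h (by linarith)
  rw [split hu, split hv]
  nlinarith

/-- The right side is `u((u+v)^α - u^α) + v((u+v)^α - v^α)`, hence at least `2uv(u+v)^{α-1}`, and
twice the larger of `u`, `v` is at least `u + v`. -/
theorem min_mul_rpow_le (hα : 1 < α) {u v : ℝ} (hu : 0 ≤ u) (hv : 0 ≤ v) :
    min u v * (u + v) ^ α ≤ (u + v) * (u + v) ^ α - u * u ^ α - v * v ^ α := by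
  wlog h : v ≤ u generalizing u v
  · have := this hv hu (le_of_not_ge h)
    rw [min_comm, add_comm u v]; linarith
  rw [min_eq_right h]
  have h1 := rpow_sub_one_mul_sub_le hα hu (le_add_of_nonneg_right hv)
  have h2 := rpow_sub_one_mul_sub_le hα hv (le_add_of_nonneg_left hu)
  have h3 : (u + v) ^ α = (u + v) ^ (α - 1) * (u + v) := by
    rcases (add_nonneg hu hv).eq_or_lt with h | h
    · rw [← h, mul_zero, Real.zero_rpow (by linarith)]
    · rw [← Real.rpow_add_one h.ne']; congr 1; ring
  have h4 : 0 ≤ (u + v) ^ (α - 1) := Real.rpow_nonneg (add_nonneg hu hv) _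
  have e1 := mul_le_mul_of_nonneg_left h1 hu
  have e2 := mul_le_mul_of_nonneg_left h2 hv
  have e3 : 0 ≤ (u + v) ^ (α - 1) * (v * (u - v)) :=
    mul_nonneg h4 (mul_nonneg hv (sub_nonneg.2 h))
  rw [h3] at e1 e2 ⊢
  nlinarith

/-- The lower bound for the resonance function. -/
theorem mul_rpow_le_abs_resonance (hα : 1 < α) {x y z m : ℝ} (hsum : x + y + z = 0)
    (hx : m ≤ |x|) (hy : m ≤ |y|) (hz : m ≤ |z|) :
    m * |x| ^ α ≤ |x * |x| ^ α + y * |y| ^ α + z * |z| ^ α| := by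
  have key : ∀ {u v w : ℝ}, 0 ≤ u → 0 ≤ v → w ≤ u + v → 0 ≤ w → m ≤ u → m ≤ v →
      m * w ^ α ≤ (u + v) * (u + v) ^ α - u * u ^ α - v * v ^ α := by
    intro u v w hu hv hw hw0 hmu hmv
    refine le_trans ?_ (min_mul_rpow_le hα hu hv)
    exact mul_le_mul (le_min hmu hmv) (Real.rpow_le_rpow hw0 hw (by linarith))
      (Real.rpow_nonneg hw0 _) (le_min hu hv)
  have key' : ∀ {u v w t : ℝ}, u + v + t = 0 → (0 ≤ u ∧ 0 ≤ v ∨ u ≤ 0 ∧ v ≤ 0) →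
      |w| ≤ |u| + |v| → m ≤ |u| → m ≤ |v| →
      m * |w| ^ α ≤ |u * |u| ^ α + v * |v| ^ α + t * |t| ^ α| := by
    intro u v w t ht hs hw hu hv
    have h := key (abs_nonneg u) (abs_nonneg v) hw (abs_nonneg w) hu hv
    obtain rfl : t = -(u + v) := by linarith
    rcases hs with ⟨h1, h2⟩ | ⟨h1, h2⟩
    · rw [abs_neg, abs_of_nonneg h1, abs_of_nonneg h2, abs_of_nonneg (add_nonneg h1 h2)] at *
      refine h.trans (le_trans ?_ (neg_le_abs _))
      linarith
    · rw [abs_neg, abs_of_nonpos h1, abs_of_nonpos h2, abs_of_nonpos (add_nonpos h1 h2)] at *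
      rw [show -u + -v = -(u + v) by ring] at h
      refine h.trans (le_trans ?_ (le_abs_self _))
      linarith
  have hxy : ∀ {u v : ℝ}, |u| ≤ |u| + |v| := fun {u v} => le_add_of_nonneg_right (abs_nonneg v)
  have hyz : |x| ≤ |y| + |z| := by
    rw [show x = -(y + z) by linarith, abs_neg]; exact abs_add_le y z
  have c1 : x * |x| ^ α + y * |y| ^ α + z * |z| ^ α = x * |x| ^ α + z * |z| ^ α + y * |y| ^ α := by
    ring
  have c2 : x * |x| ^ α + y * |y| ^ α + z * |z| ^ α = y * |y| ^ α + z * |z| ^ α + x * |x| ^ α := by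
    ring
  -- Two of the three numbers share a sign; the third is minus their sum and has the largest
  -- modulus.
  rcases le_total 0 x with h1 | h1 <;> rcases le_total 0 y with h2 | h2
  · exact key' hsum (Or.inl ⟨h1, h2⟩) hxy hx hy
  · rcases le_total 0 z with h3 | h3
    · rw [c1]; exact key' (by linarith) (Or.inl ⟨h1, h3⟩) hxy hx hz
    · rw [c2]; exact key' (by linarith) (Or.inr ⟨h2, h3⟩) hyz hy hz
  · rcases le_total 0 z with h3 | h3
    · rw [c2]; exact key' (by linarith) (Or.inl ⟨h2, h3⟩) hyz hy hz
    · rw [c1]; exact key' (by linarith) (Or.inr ⟨h1, h3⟩) hxy hx hz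
  · exact key' hsum (Or.inr ⟨h1, h2⟩) hxy hx hy

theorem bilinearGain_comm (α ξ η : ℝ) : bilinearGain α ξ η = bilinearGain α η ξ := by
  unfold bilinearGain
  simp only [abs_sub_comm ξ η, abs_sub_comm (|ξ| ^ α), add_comm ξ η, and_comm]

theorem abs_rpow_sub_le_bilinearGain (α ξ η : ℝ) :
    |ξ| ^ α - |η| ^ α ≤ bilinearGain α ξ η := by
  unfold bilinearGain
  have : 0 ≤ |ξ + η| ^ ((α - 1) / 2) := by positivity
  have := le_abs_self (|ξ| ^ α - |η| ^ α)
  split_ifs <;> linarith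

theorem transversal_le_bilinearGain (hα : 1 < α) {ξ η : ℝ} (h : |η| ≤ |ξ|) :
    |ξ| ^ (α - 1) * (|ξ| - |η|) ≤ bilinearGain α ξ η :=
  (rpow_sub_one_mul_sub_le hα (abs_nonneg _) h).trans (abs_rpow_sub_le_bilinearGain _ _ _)

theorem one_le_bilinearGain {ξ η : ℝ} (hξ : |ξ| ≤ 2) (hη : |η| ≤ 2) : 1 ≤ bilinearGain α ξ η := by
  unfold bilinearGain
  have : 0 ≤ |ξ + η| ^ ((α - 1) / 2) := by positivity
  have := abs_nonneg (|ξ| ^ α - |η| ^ α)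
  rw [if_pos (And.intro hξ hη)]
  split_ifs <;> linarith

/-- Dividing the base by `c` costs at most a factor `c` if the exponent is at most one. -/
theorem rpow_le_mul_rpow_of_le_mul {x y c e : ℝ} (hx : 0 ≤ x) (hy : 0 ≤ y) (hc : 1 ≤ c)
    (he : 0 ≤ e) (he' : e ≤ 1) (h : x ≤ c * y) : x ^ e ≤ c * y ^ e := by
  calc x ^ e ≤ (c * y) ^ e := Real.rpow_le_rpow hx h he
    _ = c ^ e * y ^ e := Real.mul_rpow (by linarith) hy
    _ ≤ c ^ (1 : ℝ) * y ^ e := by gcongr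
    _ = c * y ^ e := by rw [Real.rpow_one]

/-- For comparable frequencies either the interaction is transversal or almost parallel. -/
theorem rpow_le_bilinearGain_of_comparable (hα : 1 < α) (hα2 : α < 2) {ξ η N : ℝ} (hN : 2 ≤ N)
    (h : |η| ≤ |ξ|) (hξ : N ≤ 4 * |ξ|) (hs : N ≤ 4 * |ξ + η|) (hs' : |ξ + η| ≤ 2 * N) :
    N ^ ((α - 1) / 2) ≤ 8 * bilinearGain α ξ η := by
  have hN0 : 0 < N := by linarith
  have hs0 : 0 < |ξ + η| := by linarith
  by_cases hd : |ξ - η| ≤ |ξ + η| ^ (-((α - 1) / 2))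
  · have h1 : |ξ + η| ^ ((α - 1) / 2) ≤ bilinearGain α ξ η := by
      unfold bilinearGain
      have := abs_nonneg (|ξ| ^ α - |η| ^ α)
      rw [if_pos hd]
      split_ifs <;> linarith
    have h2 := rpow_le_mul_rpow_of_le_mul hN0.le hs0.le (by norm_num) (by linarith)
      (by linarith : (α - 1) / 2 ≤ 1) hs
    have := bilinearGain_nonneg α ξ η
    linarith
  · push Not at hd
    have h1 := transversal_le_bilinearGain hα h
    have h2 := rpow_le_mul_rpow_of_le_mul hN0.le (abs_nonneg ξ) (by norm_num) (by linarith)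
      (by linarith : α - 1 ≤ 1) hξ
    have hP : 0 < N ^ ((α - 1) / 2) := by positivity
    have hNN : N ^ (α - 1) = N ^ ((α - 1) / 2) * N ^ ((α - 1) / 2) := by
      rw [← Real.rpow_add hN0]; congr 1; ring
    have hone : 1 ≤ N ^ ((α - 1) / 2) := Real.one_le_rpow (by linarith) (by linarith)
    -- Away from the parallel set both `|ξ + η|` and `|ξ - η|` are at least of order `N^{-(α-1)/2}`,
    -- and `|ξ| - |η|` is the smaller of them. Multiplying by `|ξ|^{α-1}` leaves half of the
    -- exponent.
    have h3 : 1 ≤ 2 * (N ^ ((α - 1) / 2) * (|ξ| - |η|)) := by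
      have habs : |ξ| - |η| = min |ξ + η| |ξ - η| := by
        rcases le_total 0 ξ with a | a <;> rcases le_total 0 η with b | b <;>
          simp only [abs_of_nonneg, abs_of_nonpos, a, b] at h ⊢
        · rw [abs_of_nonneg (by linarith : 0 ≤ ξ + η), abs_of_nonneg (by linarith : 0 ≤ ξ - η),
            min_eq_right (by linarith)]
        · rw [abs_of_nonneg (by linarith : 0 ≤ ξ + η), abs_of_nonneg (by linarith : 0 ≤ ξ - η),
            min_eq_left (by linarith)]; ring
        · rw [abs_of_nonpos (by linarith : ξ + η ≤ 0), abs_of_nonpos (by linarith : ξ - η ≤ 0),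
            min_eq_left (by linarith)]; ring
        · rw [abs_of_nonpos (by linarith : ξ + η ≤ 0), abs_of_nonpos (by linarith : ξ - η ≤ 0),
            min_eq_right (by linarith)]; ring
      rw [habs]
      rcases min_choice |ξ + η| |ξ - η| with e | e <;> rw [e]
      · nlinarith
      · have h4 := rpow_le_mul_rpow_of_le_mul hs0.le hN0.le (by norm_num) (by linarith)
          (by linarith : (α - 1) / 2 ≤ 1) hs'
        rw [Real.rpow_neg hs0.le] at hd
        have hQ : 0 < |ξ + η| ^ ((α - 1) / 2) := by positivity
        have h5 : 1 ≤ |ξ + η| ^ ((α - 1) / 2) * |ξ - η| := by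
          have := mul_le_mul_of_nonneg_left hd.le hQ.le
          rwa [mul_inv_cancel₀ hQ.ne'] at this
        nlinarith [abs_nonneg (ξ - η)]
    have hd0 : 0 ≤ |ξ| - |η| := sub_nonneg.2 h
    rw [hNN] at h2
    have h6 := mul_le_mul_of_nonneg_right h2 hd0
    have h7 := mul_le_mul_of_nonneg_left h3 hP.le
    nlinarith

end Resonance

/-! ### Logarithms of the weights and the resonance relation. -/

section Modulation

variable {α : ℝ}

/-- The logarithm of the spatial bracket `⟨ξ⟩`. -/
noncomputable def logFreq (q : ℝ × ℝ) : ℝ := Real.log (jbracket q.2)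

/-- The logarithm of `⟨|τ| + |ξ|^{1+α}⟩`. -/
noncomputable def logSize (α : ℝ) (q : ℝ × ℝ) : ℝ :=
  Real.log (jbracket (|q.1| + |q.2| ^ (1 + α)))

/-- The logarithm of the modulation `⟨τ - ξ|ξ|^α⟩`. -/
noncomputable def logMod (α : ℝ) (q : ℝ × ℝ) : ℝ :=
  Real.log (jbracket (q.1 - q.2 * |q.2| ^ α))

theorem log_le_add_of_le_mul {x y c k : ℝ} (hx : 0 < x) (hy : 0 < y) (h : x ≤ c * y)
    (hc : c ≤ Real.exp k) : Real.log x ≤ Real.log y + k := by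
  rw [Real.log_le_iff_le_exp hx, Real.exp_add, Real.exp_log hy, mul_comm]
  exact h.trans (mul_le_mul_of_nonneg_right hc hy.le)

theorem two_le_exp_one : (2 : ℝ) ≤ Real.exp 1 := by linarith [Real.exp_one_gt_d9]

theorem four_le_exp_two : (4 : ℝ) ≤ Real.exp 2 := by
  have h := two_le_exp_one
  rw [show (2 : ℝ) = 1 + 1 by norm_num, Real.exp_add]; nlinarith

theorem seventeen_le_exp_four : (17 : ℝ) ≤ Real.exp 4 := by
  have h := Real.exp_one_gt_d9
  have h2 : (7 : ℝ) ≤ Real.exp 2 := by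
    rw [show (2 : ℝ) = 1 + 1 by norm_num, Real.exp_add]; nlinarith
  rw [show (4 : ℝ) = 2 + 2 by norm_num, Real.exp_add]; nlinarith

theorem logFreq_nonneg (q : ℝ × ℝ) : 0 ≤ logFreq q := Real.log_nonneg (one_le_jbracket _)

theorem logSize_nonneg (α : ℝ) (q : ℝ × ℝ) : 0 ≤ logSize α q := Real.log_nonneg (one_le_jbracket _)

theorem logMod_nonneg (α : ℝ) (q : ℝ × ℝ) : 0 ≤ logMod α q := Real.log_nonneg (one_le_jbracket _)

theorem log_abs_le_logFreq {q : ℝ × ℝ} (hq : q.2 ≠ 0) : Real.log |q.2| ≤ logFreq q :=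
  Real.log_le_log (abs_pos.2 hq) (abs_le_jbracket _)

theorem logFreq_le_of_abs_le {q : ℝ × ℝ} {X : ℝ} (hX : 1 ≤ X) (h : |q.2| ≤ X) :
    logFreq q ≤ Real.log X + 1 :=
  log_le_add_of_le_mul (jbracket_pos _) (by linarith)
    ((jbracket_le_one_add_abs _).trans (by linarith)) two_le_exp_one

theorem abs_mul_abs_rpow (hα : 1 < α) (x : ℝ) : |x * |x| ^ α| = |x| ^ (1 + α) := by
  rw [abs_mul, abs_of_nonneg (Real.rpow_nonneg (abs_nonneg x) α)]
  rcases eq_or_ne x 0 with rfl | hx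
  · rw [abs_zero, zero_mul, Real.zero_rpow (by linarith)]
  · rw [add_comm, Real.rpow_add_one (abs_pos.2 hx).ne', mul_comm]

theorem logMod_le_logSize (hα : 1 < α) (q : ℝ × ℝ) : logMod α q ≤ logSize α q := by
  refine Real.log_le_log (jbracket_pos _) (jbracket_le_of_abs_le ?_)
  rw [abs_of_nonneg (by positivity : 0 ≤ |q.1| + |q.2| ^ (1 + α)), ← abs_mul_abs_rpow hα]
  exact abs_sub _ _

theorem mul_log_le_logSize {q : ℝ × ℝ} (hq : q.2 ≠ 0) :
    (1 + α) * Real.log |q.2| ≤ logSize α q := by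
  rw [← Real.log_rpow (abs_pos.2 hq)]
  refine Real.log_le_log (Real.rpow_pos_of_pos (abs_pos.2 hq) _) ?_
  refine le_trans ?_ ((le_abs_self _).trans (abs_le_jbracket _))
  exact le_add_of_nonneg_left (abs_nonneg _)

theorem logSize_le_max (hα : 1 < α) {q : ℝ × ℝ} (hq : q.2 ≠ 0) :
    logSize α q ≤ max (logMod α q) ((1 + α) * Real.log |q.2|) + 2 := by
  have hX : 0 < |q.2| ^ (1 + α) := Real.rpow_pos_of_pos (abs_pos.2 hq) _
  rw [← Real.log_rpow (abs_pos.2 hq)]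
  have h1 : |q.1| ≤ |q.1 - q.2 * |q.2| ^ α| + |q.2| ^ (1 + α) := by
    rw [← abs_mul_abs_rpow hα]
    linarith [abs_sub_abs_le_abs_sub q.1 (q.2 * |q.2| ^ α)]
  have h2 := jbracket_le_one_add_abs (|q.1| + |q.2| ^ (1 + α))
  rw [abs_of_nonneg (by positivity : 0 ≤ |q.1| + |q.2| ^ (1 + α))] at h2
  have h3 := abs_le_jbracket (q.1 - q.2 * |q.2| ^ α)
  have h4 := one_le_jbracket (q.1 - q.2 * |q.2| ^ α)
  rcases le_total (jbracket (q.1 - q.2 * |q.2| ^ α)) (|q.2| ^ (1 + α)) with h | h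
  · refine (log_le_add_of_le_mul (jbracket_pos _) hX ?_ four_le_exp_two).trans
      (add_le_add_left (le_max_right _ _) _)
    linarith
  · refine (log_le_add_of_le_mul (jbracket_pos _) (jbracket_pos _) ?_ four_le_exp_two).trans
      (add_le_add_left (le_max_left _ _) _)
    linarith

theorem rpow_add_le_eight_mul (hα : 1 < α) (hα2 : α < 2) {x y : ℝ} (hx : 0 ≤ x) (hy : 0 ≤ y) :
    (x + y) ^ (1 + α) ≤ 8 * (x ^ (1 + α) + y ^ (1 + α)) := by
  wlog h : y ≤ x generalizing x y
  · rw [add_comm x, add_comm (x ^ _)]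
    exact this hy hx (le_of_not_ge h)
  have h2 : (2 : ℝ) ^ (1 + α) ≤ 8 := by
    calc (2 : ℝ) ^ (1 + α) ≤ 2 ^ (3 : ℝ) :=
          Real.rpow_le_rpow_of_exponent_le (by norm_num) (by linarith)
      _ = 8 := by norm_num
  have hy' : 0 ≤ y ^ (1 + α) := Real.rpow_nonneg hy _
  have hx' : 0 ≤ x ^ (1 + α) := Real.rpow_nonneg hx _
  calc (x + y) ^ (1 + α) ≤ (2 * x) ^ (1 + α) :=
        Real.rpow_le_rpow (by linarith) (by linarith) (by linarith)
    _ = 2 ^ (1 + α) * x ^ (1 + α) := Real.mul_rpow (by norm_num) hx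
    _ ≤ 8 * x ^ (1 + α) := by gcongr
    _ ≤ _ := by linarith

theorem logSize_add_le (hα : 1 < α) (hα2 : α < 2) (p q : ℝ × ℝ) :
    logSize α (p + q) ≤ max (logSize α p) (logSize α q) + 4 := by
  have h0 : |(p + q).2| ^ (1 + α) ≤ 8 * (|p.2| ^ (1 + α) + |q.2| ^ (1 + α)) :=
    (Real.rpow_le_rpow (abs_nonneg _) (abs_add_le _ _) (by linarith)).trans
      (rpow_add_le_eight_mul hα hα2 (abs_nonneg _) (abs_nonneg _))
  have h1 : |(p + q).1| ≤ |p.1| + |q.1| := abs_add_le _ _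
  have h2 := jbracket_le_one_add_abs (|(p + q).1| + |(p + q).2| ^ (1 + α))
  rw [abs_of_nonneg (by positivity : 0 ≤ |(p + q).1| + |(p + q).2| ^ (1 + α))] at h2
  have h3 := (le_abs_self _).trans (abs_le_jbracket (|p.1| + |p.2| ^ (1 + α)))
  have h4 := (le_abs_self _).trans (abs_le_jbracket (|q.1| + |q.2| ^ (1 + α)))
  have h5 := one_le_jbracket (|p.1| + |p.2| ^ (1 + α))
  have h6 := one_le_jbracket (|q.1| + |q.2| ^ (1 + α))
  have h7 := abs_nonneg p.1
  have h8 := abs_nonneg q.1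
  rcases le_total (jbracket (|p.1| + |p.2| ^ (1 + α))) (jbracket (|q.1| + |q.2| ^ (1 + α)))
    with h | h
  · refine (log_le_add_of_le_mul (jbracket_pos _) (jbracket_pos _) ?_ seventeen_le_exp_four).trans
      (add_le_add_left (le_max_right _ _) _)
    linarith
  · refine (log_le_add_of_le_mul (jbracket_pos _) (jbracket_pos _) ?_ seventeen_le_exp_four).trans
      (add_le_add_left (le_max_left _ _) _)
    linarith

/-- The resonance relation forces one of the three modulations to be large. -/
theorem log_resonance_le (hα : 1 < α) {p q : ℝ × ℝ} {m M : ℝ} (hp : p.2 ≠ 0) (hm : 0 < m)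
    (h0 : m ≤ |(p + q).2|) (h1 : m ≤ |p.2|) (h2 : m ≤ |q.2|) (hM0 : logMod α (p + q) ≤ M)
    (hM1 : logMod α p ≤ M) (hM2 : logMod α q ≤ M) :
    Real.log m + α * Real.log |p.2| ≤ M + 2 := by
  have hr := mul_rpow_le_abs_resonance hα (x := p.2) (y := q.2) (z := -(p + q).2) (m := m)
    (by simp) h1 h2 (by rwa [abs_neg])
  rw [abs_neg] at hr
  have hexp : ∀ {r : ℝ × ℝ}, logMod α r ≤ M → |r.1 - r.2 * |r.2| ^ α| ≤ Real.exp M := by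
    intro r hr
    exact (abs_le_jbracket _).trans ((Real.log_le_iff_le_exp (jbracket_pos _)).1 hr)
  have e0 := hexp hM0
  have e1 := hexp hM1
  have e2 := hexp hM2
  have hp' := abs_pos.2 hp
  -- The time frequencies cancel, so the resonance function is a signed sum of the three
  -- modulations.
  have hle : m * |p.2| ^ α ≤ 3 * Real.exp M := by
    refine hr.trans ?_
    rw [abs_le] at e0 e1 e2 ⊢
    have : (p + q).1 = p.1 + q.1 := rfl
    constructor <;> linarith
  have := log_le_add_of_le_mul (k := 2) (by positivity) (Real.exp_pos M) hle
    (by linarith [four_le_exp_two])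
  rwa [Real.log_exp, Real.log_mul hm.ne' (by positivity), Real.log_rpow hp'] at this

/-- The kernel carries the square root of the gain, hence `γ / 2`; the factor `3` bounds `√8`. -/
theorem exp_le_bilinearKernel {b γ : ℝ} {p q : ℝ × ℝ}
    (h : Real.exp γ ≤ 8 * bilinearGain α p.2 q.2) :
    Real.exp (γ / 2 - b * (logMod α p + logMod α q)) ≤ 3 * bilinearKernel α b p q := by
  have h1 : Real.exp (γ / 2) ≤ 3 * Real.sqrt (bilinearGain α p.2 q.2) := by
    rw [Real.exp_half, Real.sqrt_le_left (by positivity), mul_pow,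
      Real.sq_sqrt (bilinearGain_nonneg _ _ _)]
    linarith [bilinearGain_nonneg α p.2 q.2]
  have h2 : Real.exp (γ / 2 - b * (logMod α p + logMod α q)) = Real.exp (γ / 2) *
      (jbracket (p.1 - p.2 * |p.2| ^ α) ^ (-b) * jbracket (q.1 - q.2 * |q.2| ^ α) ^ (-b)) := by
    rw [Real.rpow_def_of_pos (jbracket_pos _), Real.rpow_def_of_pos (jbracket_pos _),
      ← Real.exp_add, ← Real.exp_add, logMod, logMod]
    congr 1; ring
  have h3 := fun x => (Real.rpow_pos_of_pos (jbracket_pos x) (-b)).le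
  rw [h2, bilinearKernel, ← mul_assoc 3]
  exact mul_le_mul_of_nonneg_right h1 (mul_nonneg (h3 _) (h3 _))

/-- The phase `ξ|ξ|^α` is odd, so `-(a + c)` may stand for the output frequency. -/
theorem logMod_neg (α : ℝ) (q : ℝ × ℝ) : logMod α (-q) = logMod α q := by
  rw [logMod, logMod, ← jbracket_neg]
  congr 2
  simp only [Prod.fst_neg, Prod.snd_neg, abs_neg]; ring

theorem bilinearKernel_comm (α b : ℝ) (p q : ℝ × ℝ) :
    bilinearKernel α b p q = bilinearKernel α b q p := by
  rw [bilinearKernel, bilinearKernel, bilinearGain_comm]; ring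

end Modulation

/-! ### The pointwise bound of the multiplier, by frequency regimes. -/

section Pointwise

variable {α ω p ε : ℝ}

/-- The logarithm of the multiplier of the bilinear estimate at the frequencies `a` and `c`. -/
noncomputable def logMultiplier (α ω p ε : ℝ) (a c : ℝ × ℝ) : ℝ :=
  logSymbol α ω p (Real.log |(a + c).2|) (Real.log |a.2|) (Real.log |c.2|)
    (logFreq (a + c)) (logFreq a) (logFreq c) (logSize α (a + c)) (logSize α a) (logSize α c) +
  ((-1 / 2 + 2 * ε) * logMod α (a + c) - (1 / 2 + ε) * logMod α a - (1 / 2 + ε) * logMod α c)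

/-- The sum of the bilinear kernel over the pairs of the frequencies `a`, `c`, `-(a + c)`. -/
noncomputable def kernelSum (α b : ℝ) (a c : ℝ × ℝ) : ℝ :=
  bilinearKernel α b a c + bilinearKernel α b (-(a + c)) a + bilinearKernel α b (-(a + c)) c

theorem kernelSum_comm (α b : ℝ) (a c : ℝ × ℝ) : kernelSum α b a c = kernelSum α b c a := by
  rw [kernelSum, kernelSum, add_comm c a, bilinearKernel_comm α b a c]; ring

theorem kernelSum_nonneg (α b : ℝ) (a c : ℝ × ℝ) : 0 ≤ kernelSum α b a c :=
  add_nonneg (add_nonneg (bilinearKernel_nonneg _ _ _ _) (bilinearKernel_nonneg _ _ _ _))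
    (bilinearKernel_nonneg _ _ _ _)

section Pairs

variable {b γ E : ℝ} {a c : ℝ × ℝ}

theorem exp_le_kernelSum_of_inputs (hE : E ≤ γ / 2 + 40 - b * (logMod α a + logMod α c))
    (h : Real.exp γ ≤ 8 * bilinearGain α a.2 c.2) :
    Real.exp E ≤ Real.exp 40 * (3 * kernelSum α b a c) := by
  refine (Real.exp_le_exp.2 hE).trans ?_
  rw [show γ / 2 + 40 - b * (logMod α a + logMod α c) =
    40 + (γ / 2 - b * (logMod α a + logMod α c)) by ring, Real.exp_add]
  refine mul_le_mul_of_nonneg_left ((exp_le_bilinearKernel h).trans ?_) (Real.exp_pos _).le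
  have h1 := bilinearKernel_nonneg α b (-(a + c)) a
  have h2 := bilinearKernel_nonneg α b (-(a + c)) c
  rw [kernelSum]; linarith

theorem exp_le_kernelSum_of_output_left
    (hE : E ≤ γ / 2 + 40 - b * (logMod α (a + c) + logMod α a))
    (h : Real.exp γ ≤ 8 * bilinearGain α (-(a + c)).2 a.2) :
    Real.exp E ≤ Real.exp 40 * (3 * kernelSum α b a c) := by
  refine (Real.exp_le_exp.2 hE).trans ?_
  rw [show γ / 2 + 40 - b * (logMod α (a + c) + logMod α a) =
    40 + (γ / 2 - b * (logMod α (-(a + c)) + logMod α a)) by rw [logMod_neg]; ring, Real.exp_add]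
  refine mul_le_mul_of_nonneg_left ((exp_le_bilinearKernel h).trans ?_) (Real.exp_pos _).le
  have h1 := bilinearKernel_nonneg α b a c
  have h2 := bilinearKernel_nonneg α b (-(a + c)) c
  rw [kernelSum]; linarith

theorem exp_le_kernelSum_of_output_right
    (hE : E ≤ γ / 2 + 40 - b * (logMod α (a + c) + logMod α c))
    (h : Real.exp γ ≤ 8 * bilinearGain α (-(a + c)).2 c.2) :
    Real.exp E ≤ Real.exp 40 * (3 * kernelSum α b a c) := by
  rw [kernelSum_comm]
  rw [add_comm a c] at hE h
  exact exp_le_kernelSum_of_output_left hE h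

end Pairs

section Multiplier

variable {a c : ℝ × ℝ}

/-- Moving the largest modulation into the output position costs nothing. -/
theorem exp_logMultiplier_le_of_forall_pair (h : ExponentData α ω p ε) {γ M : ℝ}
    (hM : M = max (logMod α (a + c)) (max (logMod α a) (logMod α c)))
    (hle : logSymbol α ω p (Real.log |(a + c).2|) (Real.log |a.2|) (Real.log |c.2|)
      (logFreq (a + c)) (logFreq a) (logFreq c) (logSize α (a + c)) (logSize α a) (logSize α c) +
      (-1 / 2 + 2 * ε) * M ≤ γ / 2 + 40)
    (h12 : Real.exp γ ≤ 8 * bilinearGain α a.2 c.2)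
    (h02 : Real.exp γ ≤ 8 * bilinearGain α (-(a + c)).2 c.2)
    (h01 : logMod α (a + c) ≤ logMod α c → logMod α a ≤ logMod α c →
      Real.exp γ ≤ 8 * bilinearGain α (-(a + c)).2 a.2) :
    Real.exp (logMultiplier α ω p ε a c) ≤
      Real.exp 40 * (3 * kernelSum α (1 / 2 + ε) a c) := by
  have hε := h.eps_pos
  -- If an input has the largest modulation `M`, exchanging its exponent `-(1/2 + ε)` with the
  -- output exponent `-1/2 + 2ε` changes the logarithm by `3ε(M - σ₀) ≥ 0`, where `σ₀` is `logMod α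
  -- (a + c)`. The two smaller modulations then carry the exponent that the kernel requires.
  rcases le_total (logMod α (a + c)) (max (logMod α a) (logMod α c)) with h0 | h0
  · rw [max_eq_right h0] at hM
    rcases le_total (logMod α a) (logMod α c) with h1 | h1
    · rw [max_eq_right h1] at hM h0
      subst hM
      refine exp_le_kernelSum_of_output_left ?_ (h01 h0 h1)
      unfold logMultiplier
      nlinarith
    · rw [max_eq_left h1] at hM h0
      subst hM
      refine exp_le_kernelSum_of_output_right ?_ h02
      unfold logMultiplier
      nlinarith
  · rw [max_eq_left h0] at hM
    subst hM
    refine exp_le_kernelSum_of_inputs ?_ h12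
    unfold logMultiplier
    linarith

theorem exp_logMultiplier_le_of_low (h : ExponentData α ω p ε) (ha : a.2 ≠ 0) (hc : c.2 ≠ 0)
    (hac : (a + c).2 ≠ 0) (hle : |c.2| ≤ |a.2|) (hN : |a.2| ≤ 2) :
    Real.exp (logMultiplier α ω p ε a c) ≤
      Real.exp 40 * (3 * kernelSum α (1 / 2 + ε) a c) := by
  have hX0 : |(a + c).2| ≤ |a.2| + |c.2| := abs_add_le _ _
  have log2 : Real.log 2 ≤ 1 := by linarith [Real.log_two_lt_d9]
  have hs := logSymbol_le_of_low h (x₀ := Real.log |(a + c).2|) (x₁ := Real.log |a.2|)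
    (x₂ := Real.log |c.2|) (j₀ := logFreq (a + c)) (j₁ := logFreq a) (j₂ := logFreq c)
    (l₀ := logSize α (a + c)) (l₁ := logSize α a) (l₂ := logSize α c)
    ((Real.log_le_iff_le_exp (abs_pos.2 hac)).2 (by linarith [four_le_exp_two]))
    ((Real.log_le_iff_le_exp (abs_pos.2 ha)).2 (by linarith [two_le_exp_one]))
    ((Real.log_le_iff_le_exp (abs_pos.2 hc)).2 (by linarith [two_le_exp_one]))
    (logFreq_nonneg _)
    ((logFreq_le_of_abs_le (by norm_num) hN).trans (by linarith))
    ((logFreq_le_of_abs_le (by norm_num) (hle.trans hN)).trans (by linarith))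
    (logSize_nonneg _ _) (logSize_nonneg _ _) (logSize_add_le h.one_lt h.lt_two a c)
  refine exp_le_kernelSum_of_inputs (γ := 0) ?_ ?_
  · unfold logMultiplier
    have hε := h.omega_add_le
    have := mul_nonneg (show 0 ≤ -(-1 / 2 + 2 * ε) by linarith [h.omega_nonneg])
      (logMod_nonneg α (a + c))
    linarith
  · rw [Real.exp_zero]
    linarith [one_le_bilinearGain (α := α) hN (hle.trans hN)]

theorem exp_log_add_mul_log {x y e : ℝ} (hx : 0 < x) (hy : 0 < y) :
    Real.exp (Real.log x + e * Real.log y) = x * y ^ e := by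
  rw [Real.exp_add, Real.exp_log hx, Real.rpow_def_of_pos hy, mul_comm e]

theorem exp_mul_log {y e : ℝ} (hy : 0 < y) : Real.exp (e * Real.log y) = y ^ e := by
  rw [Real.rpow_def_of_pos hy, mul_comm e]

theorem log_le_log_add_one_of_le_two_mul {x y : ℝ} (hx : 0 < x) (hy : 0 < y) (h : x ≤ 2 * y) :
    Real.log x ≤ Real.log y + 1 :=
  log_le_add_of_le_mul hx hy h two_le_exp_one

theorem log_le_log_add_two_of_le_four_mul {x y : ℝ} (hx : 0 < x) (hy : 0 < y) (h : x ≤ 4 * y) :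
    Real.log x ≤ Real.log y + 2 :=
  log_le_add_of_le_mul hx hy h four_le_exp_two

/-- All three pairs gain at least a multiple of `|ξ₀| N^{α-1}`: for the inputs `|a.2| - |c.2|`
equals the output frequency in modulus, and a pair with the output is even more transversal. -/
theorem exp_logMultiplier_le_of_low_output (h : ExponentData α ω p ε) (ha : a.2 ≠ 0)
    (hc : c.2 ≠ 0) (hac : (a + c).2 ≠ 0) (hle : |c.2| ≤ |a.2|) (hN : 2 ≤ |a.2|)
    (h0 : 4 * |(a + c).2| ≤ |a.2|) :
    Real.exp (logMultiplier α ω p ε a c) ≤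
      Real.exp 40 * (3 * kernelSum α (1 / 2 + ε) a c) := by
  have hα := h.one_lt
  have hα2 := h.lt_two
  have hsum : (a + c).2 = a.2 + c.2 := rfl
  have hpa := abs_pos.2 ha
  have hpc := abs_pos.2 hc
  have hp0 := abs_pos.2 hac
  have hc3 : |a.2| ≤ |(a + c).2| + |c.2| := by
    rw [show a.2 = (a + c).2 + -c.2 by rw [hsum]; ring]
    simpa using abs_add_le (a + c).2 (-c.2)
  -- A small output forces inputs of opposite signs.
  have hdiff : |a.2| - |c.2| = |(a + c).2| := by
    rw [hsum] at h0 ⊢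
    rcases le_total 0 a.2 with s | s <;> rcases le_total 0 c.2 with t | t <;>
      simp only [abs_of_nonneg, abs_of_nonpos, s, t] at hle hN h0 ⊢
    · rw [abs_of_nonneg (by linarith)] at h0; linarith
    · rw [abs_of_nonneg (by linarith)]; ring
    · rw [abs_of_nonpos (by linarith)]; ring
    · rw [abs_of_nonpos (by linarith)] at h0; linarith
  set M := max (logMod α (a + c)) (max (logMod α a) (logMod α c)) with hM
  have m0 : logMod α (a + c) ≤ M := le_max_left _ _
  have m1 : logMod α a ≤ M := (le_max_left _ _).trans (le_max_right _ _)
  have m2 : logMod α c ≤ M := (le_max_right _ _).trans (le_max_right _ _)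
  have hr := log_resonance_le hα ha hp0 le_rfl (by linarith) (by linarith) m0 m1 m2
  have hn : 0 ≤ Real.log |a.2| := Real.log_nonneg (by linarith)
  have hx0 : Real.log |(a + c).2| ≤ Real.log |a.2| := Real.log_le_log hp0 (by linarith)
  have hl1 := mul_log_le_logSize (α := α) ha
  have hl2 := mul_log_le_logSize (α := α) hc
  have hx2 := log_le_log_add_one_of_le_two_mul hpa hpc (by linarith)
  have hα1 := mul_nonneg hn (by linarith : 0 ≤ α)
  have hα3 := mul_nonneg (sub_nonneg.2 hx2) (by linarith : 0 ≤ 1 + α)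
  have hα4 := mul_nonneg (sub_nonneg.2 hx0) (by linarith : 0 ≤ α)
  have hl0 : logSize α (a + c) ≤ M + 6 := by
    refine (logSize_le_max hα hac).trans ?_
    have : max (logMod α (a + c)) ((1 + α) * Real.log |(a + c).2|) ≤ M + 2 :=
      max_le (by linarith) (by linarith)
    linarith
  have hs := logSymbol_le_of_low_output (l₁ := logSize α a) (l₂ := logSize α c) h hn hx0
    le_rfl (Real.log_le_log hpc hle) (logFreq_nonneg (a + c)) (logFreq_le_of_abs_le (by linarith) le_rfl)
    (logFreq_le_of_abs_le (by linarith) hle) (by linarith) (by linarith) hl0 hr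
  have hγ := exp_log_add_mul_log (e := α - 1) hp0 hpa
  have hP : 0 < |a.2| ^ (α - 1) := Real.rpow_pos_of_pos hpa _
  refine exp_logMultiplier_le_of_forall_pair h hM hs ?_ ?_ fun _ _ => ?_
  · rw [hγ]
    have := transversal_le_bilinearGain hα hle
    rw [hdiff] at this
    nlinarith
  · rw [hγ, bilinearGain_comm]
    have := transversal_le_bilinearGain hα (ξ := c.2) (η := (-(a + c)).2)
      (by rw [Prod.snd_neg, abs_neg]; linarith)
    have h3 := rpow_le_mul_rpow_of_le_mul hpa.le hpc.le (by norm_num) (by linarith)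
      (by linarith : α - 1 ≤ 1) (by linarith : |a.2| ≤ 2 * |c.2|)
    rw [Prod.snd_neg, abs_neg] at this
    have h4 : |(a + c).2| ≤ |c.2| - |(a + c).2| := by linarith
    have h5 := mul_le_mul_of_nonneg_left h4 (Real.rpow_nonneg hpc.le (α - 1))
    have h6 := mul_le_mul_of_nonneg_right h3 hp0.le
    rw [Prod.snd_neg]
    linarith [bilinearGain_nonneg α c.2 (-(a + c).2)]
  · rw [hγ, bilinearGain_comm]
    have := transversal_le_bilinearGain hα (ξ := a.2) (η := (-(a + c)).2)
      (by rw [Prod.snd_neg, abs_neg]; linarith)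
    rw [Prod.snd_neg, abs_neg] at this
    have h4 : |(a + c).2| ≤ |a.2| - |(a + c).2| := by linarith
    have h5 := mul_le_mul_of_nonneg_left h4 hP.le
    rw [Prod.snd_neg]
    linarith [bilinearGain_nonneg α a.2 (-(a + c).2)]

/-- Each pair sums to minus the third frequency, itself comparable to `N`, so the gain `N^{(α-1)/2}`
is available whichever modulation is largest. -/
theorem exp_logMultiplier_le_of_comparable (h : ExponentData α ω p ε) (ha : a.2 ≠ 0)
    (hc : c.2 ≠ 0) (hac : (a + c).2 ≠ 0) (hle : |c.2| ≤ |a.2|) (hN : 2 ≤ |a.2|)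
    (h0 : |a.2| ≤ 4 * |(a + c).2|) (h2 : |a.2| ≤ 4 * |c.2|) :
    Real.exp (logMultiplier α ω p ε a c) ≤
      Real.exp 40 * (3 * kernelSum α (1 / 2 + ε) a c) := by
  have hα := h.one_lt
  have hα2 := h.lt_two
  have hsum : (a + c).2 = a.2 + c.2 := rfl
  have hX0 : |(a + c).2| ≤ |a.2| + |c.2| := abs_add_le _ _
  have hpa := abs_pos.2 ha
  have hpc := abs_pos.2 hc
  have hp0 := abs_pos.2 hac
  set M := max (logMod α (a + c)) (max (logMod α a) (logMod α c)) with hM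
  have m0 : logMod α (a + c) ≤ M := le_max_left _ _
  have m1 : logMod α a ≤ M := (le_max_left _ _).trans (le_max_right _ _)
  have m2 : logMod α c ≤ M := (le_max_right _ _).trans (le_max_right _ _)
  have hr := log_resonance_le hα ha (m := |a.2| / 4) (by linarith) (by linarith) (by linarith)
    (by linarith) m0 m1 m2
  have hm4 := log_le_log_add_two_of_le_four_mul hpa (by linarith : 0 < |a.2| / 4) (by linarith)
  have hn : 0 ≤ Real.log |a.2| := Real.log_nonneg (by linarith)
  have hl1 := mul_log_le_logSize (α := α) ha
  have hl2 := mul_log_le_logSize (α := α) hc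
  have hx0 := log_le_log_add_one_of_le_two_mul hp0 hpa (by linarith)
  have hx0' := log_le_log_add_two_of_le_four_mul hpa hp0 h0
  have hx2 := log_le_log_add_two_of_le_four_mul hpa hpc h2
  have hj0 := log_abs_le_logFreq hac
  have hα3 := mul_nonneg (sub_nonneg.2 hx2) (by linarith : 0 ≤ 1 + α)
  have hs := logSymbol_le_of_comparable h hn hx0 le_rfl (Real.log_le_log hpc hle) (by linarith)
    (logFreq_le_of_abs_le (by linarith) le_rfl)
    (logFreq_le_of_abs_le (by linarith) hle) (by linarith) (by linarith)
    (logSize_add_le hα hα2 a c) (by linarith : (1 + α) * Real.log |a.2| ≤ M + 4)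
  have hγ := exp_mul_log (e := (α - 1) / 2) hpa
  have key : ∀ {ξ η : ℝ}, |a.2| ≤ 4 * |ξ| → |a.2| ≤ 4 * |η| → |a.2| ≤ 4 * |ξ + η| →
      |ξ + η| ≤ 2 * |a.2| → |a.2| ^ ((α - 1) / 2) ≤ 8 * bilinearGain α ξ η := by
    intro ξ η e1 e2 e3 e4
    rcases le_total |η| |ξ| with g | g
    · exact rpow_le_bilinearGain_of_comparable hα hα2 hN g e1 e3 e4
    · rw [bilinearGain_comm]
      rw [add_comm] at e3 e4
      exact rpow_le_bilinearGain_of_comparable hα hα2 hN g e2 e3 e4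
  have hneg : |(-(a + c)).2| = |(a + c).2| := by rw [Prod.snd_neg, abs_neg]
  refine exp_logMultiplier_le_of_forall_pair h hM hs ?_ ?_ fun _ _ => ?_ <;> rw [hγ]
  · exact key (by linarith) h2 (by rw [← hsum]; exact h0) (by rw [← hsum]; linarith)
  · have e : (-(a + c)).2 + c.2 = -a.2 := by rw [Prod.snd_neg, hsum]; ring
    exact key (by rw [hneg]; exact h0) h2 (by rw [e, abs_neg]; linarith)
      (by rw [e, abs_neg]; linarith)
  · have e : (-(a + c)).2 + a.2 = -c.2 := by rw [Prod.snd_neg, hsum]; ring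
    exact key (by rw [hneg]; exact h0) (by linarith) (by rw [e, abs_neg]; linarith)
      (by rw [e, abs_neg]; linarith)

/-- Pairs containing the low frequency gain `N^α`, but the output and `a` only gain `|ξ₂| N^{α-1}`.
The case where `c` has the largest modulation is therefore separate: for `|ξ₂| ≤ 1` the pair of
inputs is kept and the weight of `c` supplies the decay, for `|ξ₂| ≥ 1` the weaker gain suffices. -/
theorem exp_logMultiplier_le_of_low_input (h : ExponentData α ω p ε) (ha : a.2 ≠ 0)
    (hc : c.2 ≠ 0) (hac : (a + c).2 ≠ 0) (hN : 2 ≤ |a.2|) (h2 : 4 * |c.2| ≤ |a.2|) :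
    Real.exp (logMultiplier α ω p ε a c) ≤
      Real.exp 40 * (3 * kernelSum α (1 / 2 + ε) a c) := by
  have hα := h.one_lt
  have hα2 := h.lt_two
  have hε := h.eps_pos
  have hsum : (a + c).2 = a.2 + c.2 := rfl
  have hX0 : |(a + c).2| ≤ |a.2| + |c.2| := abs_add_le _ _
  have hX0' : |a.2| ≤ |(a + c).2| + |c.2| := by
    rw [show a.2 = (a + c).2 + -c.2 by rw [hsum]; ring]
    simpa using abs_add_le (a + c).2 (-c.2)
  have hpa := abs_pos.2 ha
  have hpc := abs_pos.2 hc
  have hp0 := abs_pos.2 hac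
  set M := max (logMod α (a + c)) (max (logMod α a) (logMod α c)) with hM
  have m0 : logMod α (a + c) ≤ M := le_max_left _ _
  have m1 : logMod α a ≤ M := (le_max_left _ _).trans (le_max_right _ _)
  have m2 : logMod α c ≤ M := (le_max_right _ _).trans (le_max_right _ _)
  have hr := log_resonance_le hα ha hpc (by linarith) (by linarith) le_rfl m0 m1 m2
  have hn : 0 ≤ Real.log |a.2| := Real.log_nonneg (by linarith)
  have hl1 := mul_log_le_logSize (α := α) ha
  have hl2 := mul_log_le_logSize (α := α) hc
  have hx0 := log_le_log_add_one_of_le_two_mul hp0 hpa (by linarith)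
  have hx0' := log_le_log_add_one_of_le_two_mul hpa hp0 (by linarith)
  have hx2 : Real.log |c.2| ≤ Real.log |a.2| := Real.log_le_log hpc (by linarith)
  have hj0 := log_abs_le_logFreq hac
  have hj1 := logFreq_le_of_abs_le (q := a) (by linarith) le_rfl
  have hls := logSize_add_le hα hα2 a c
  have hα1 := mul_nonneg hn (by linarith : 0 ≤ α)
  have hγ := exp_mul_log (e := α) hpa
  have hNα : |a.2| ^ α = |a.2| ^ (α - 1) * |a.2| := by
    rw [← Real.rpow_add_one hpa.ne']; congr 1; ring
  have hP : 0 < |a.2| ^ (α - 1) := Real.rpow_pos_of_pos hpa _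
  have h12 : Real.exp (α * Real.log |a.2|) ≤ 8 * bilinearGain α a.2 c.2 := by
    rw [hγ, hNα]
    have := transversal_le_bilinearGain hα (ξ := a.2) (η := c.2) (by linarith)
    have h4 : |a.2| ≤ 2 * (|a.2| - |c.2|) := by linarith
    have h5 := mul_le_mul_of_nonneg_left h4 hP.le
    linarith [bilinearGain_nonneg α a.2 c.2]
  have h02 : Real.exp (α * Real.log |a.2|) ≤ 8 * bilinearGain α (-(a + c)).2 c.2 := by
    rw [hγ, hNα, Prod.snd_neg]
    have := transversal_le_bilinearGain hα (ξ := -(a + c).2) (η := c.2)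
      (by rw [abs_neg]; linarith)
    rw [abs_neg] at this
    have h3 := rpow_le_mul_rpow_of_le_mul hpa.le hp0.le (by norm_num) (by linarith)
      (by linarith : α - 1 ≤ 1) (by linarith : |a.2| ≤ 2 * |(a + c).2|)
    have h4 : |a.2| ≤ 2 * (|(a + c).2| - |c.2|) := by linarith
    have h5 := mul_le_mul_of_nonneg_left h4 (Real.rpow_nonneg hp0.le (α - 1))
    have h6 := mul_le_mul_of_nonneg_right h3 hpa.le
    linarith [bilinearGain_nonneg α (-(a + c).2) c.2]
  by_cases hmax : logMod α (a + c) ≤ logMod α c ∧ logMod α a ≤ logMod α c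
  · have hMc : M = logMod α c := by
      rw [hM, max_eq_right hmax.2, max_eq_right hmax.1]
    have hl2' := logMod_le_logSize hα c
    rcases le_total |c.2| 1 with hlow | hmed
    · have hx2' : Real.log |c.2| ≤ 0 := Real.log_nonpos hpc.le hlow
      have hs := logSymbol_le_of_low_input_max h (j₀ := logFreq (a + c)) hx0 le_rfl
        (by linarith) hj1 (by simpa using logFreq_le_of_abs_le le_rfl hlow)
        (x₂ := Real.log |c.2|) (l₁ := logSize α a) (l₂ := logSize α c)
        (by linarith) (by linarith) hls
      refine exp_le_kernelSum_of_inputs (γ := α * Real.log |a.2|) ?_ h12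
      unfold logMultiplier
      have := mul_nonneg (show 0 ≤ -(-1 / 2 + 2 * ε) by
        linarith [h.omega_nonneg, h.omega_add_le]) (logMod_nonneg α (a + c))
      linarith
    · have hs := logSymbol_le_of_medium_input_max h hn (j₀ := logFreq (a + c)) hx0 le_rfl
        (Real.log_nonneg hmed) (by linarith) hj1 (logFreq_le_of_abs_le hmed le_rfl)
        (l₁ := logSize α a) (l₂ := logSize α c) (by linarith) (by linarith) hls hr
      refine exp_le_kernelSum_of_output_left (γ := Real.log |c.2| + (α - 1) * Real.log |a.2|)
        ?_ ?_
      · unfold logMultiplier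
        rw [hMc] at hs
        nlinarith
      · rw [exp_log_add_mul_log hpc hpa, Prod.snd_neg]
        have hdiff : |(|(a + c).2| - |a.2|)| = |c.2| := by
          rw [hsum] at *
          rcases le_total 0 a.2 with s | s
          · rw [abs_of_nonneg s] at *
            rw [abs_of_nonneg (by linarith [neg_abs_le c.2] : 0 ≤ a.2 + c.2)]
            congr 1; ring
          · rw [abs_of_nonpos s] at *
            rw [abs_of_nonpos (by linarith [le_abs_self c.2] : a.2 + c.2 ≤ 0),
              show -(a.2 + c.2) - -a.2 = -c.2 by ring, abs_neg]
        rcases le_total |a.2| |(a + c).2| with g | g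
        · have := transversal_le_bilinearGain hα (ξ := -(a + c).2) (η := a.2)
            (by rwa [abs_neg])
          rw [abs_of_nonneg (sub_nonneg.2 g)] at hdiff
          rw [abs_neg, hdiff] at this
          have h3 := Real.rpow_le_rpow hpa.le g (by linarith : 0 ≤ α - 1)
          nlinarith
        · have := transversal_le_bilinearGain hα (ξ := a.2) (η := -(a + c).2)
            (by rwa [abs_neg])
          rw [abs_of_nonpos (by linarith)] at hdiff
          rw [abs_neg, show |a.2| - |(a + c).2| = |c.2| by linarith] at this
          rw [bilinearGain_comm]
          nlinarith
  · have hcontra : ∀ {P : Prop}, logMod α (a + c) ≤ logMod α c → logMod α a ≤ logMod α c → P :=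
      fun e1 e2 => absurd ⟨e1, e2⟩ hmax
    refine exp_logMultiplier_le_of_forall_pair h (γ := α * Real.log |a.2|) hM ?_ h12 h02
      fun e1 e2 => hcontra e1 e2
    rcases le_total |c.2| 1 with hlow | hmed
    · exact logSymbol_le_of_low_input h hx0 le_rfl (by linarith) hj1
        (by simpa using logFreq_le_of_abs_le le_rfl hlow) (logSize_nonneg _ _)
        (logSize_nonneg _ _) hls ((logMod_nonneg _ _).trans m0) hr
    · exact logSymbol_le_of_medium_input h hn hx0 le_rfl (Real.log_nonneg hmed) hx2
        (by linarith) hj1 (logFreq_le_of_abs_le hmed le_rfl) (by linarith) (by linarith) hls hr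

theorem exp_logMultiplier_le (h : ExponentData α ω p ε) (ha : a.2 ≠ 0)
    (hc : c.2 ≠ 0) (hac : (a + c).2 ≠ 0) :
    Real.exp (logMultiplier α ω p ε a c) ≤
      Real.exp 40 * (3 * kernelSum α (1 / 2 + ε) a c) := by
  wlog hle : |c.2| ≤ |a.2| generalizing a c
  · rw [kernelSum_comm]
    refine le_of_eq_of_le ?_ (this hc ha (by rwa [add_comm]) (le_of_not_ge hle))
    unfold logMultiplier logSymbol
    rw [add_comm c a]; congr 1; ring
  rcases le_total |a.2| 2 with hN | hN
  · exact exp_logMultiplier_le_of_low h ha hc hac hle hN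
  rcases le_total |a.2| (4 * |c.2|) with h2 | h2
  · rcases le_total |a.2| (4 * |(a + c).2|) with h0 | h0
    · exact exp_logMultiplier_le_of_comparable h ha hc hac hle hN h0 h2
    · exact exp_logMultiplier_le_of_low_output h ha hc hac hle hN h0
  · exact exp_logMultiplier_le_of_low_input h ha hc hac hN h2

end Multiplier

end Pointwise

/-! ### From the multiplier to the Bourgain weights. -/

section Weights

variable {α s s' ω b p ε : ℝ}

/-- The square root of the weight of the Bourgain norm. -/
noncomputable def bourgainWeightRoot (α s ω b : ℝ) (q : ℝ × ℝ) : ℝ :=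
  |q.2| ^ (-ω) * jbracket q.2 ^ (s - α * ω) * jbracket (|q.1| + |q.2| ^ (1 + α)) ^ ω *
    jbracket (q.1 - q.2 * |q.2| ^ α) ^ b

theorem bourgainWeightRoot_nonneg (α s ω b : ℝ) (q : ℝ × ℝ) : 0 ≤ bourgainWeightRoot α s ω b q := by
  have h := fun x e => (Real.rpow_pos_of_pos (jbracket_pos x) e).le
  exact mul_nonneg (mul_nonneg (mul_nonneg (by positivity) (h _ _)) (h _ _)) (h _ _)

@[fun_prop]
theorem measurable_bourgainWeightRoot (α s ω b : ℝ) :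
    Measurable (bourgainWeightRoot α s ω b) := by
  unfold bourgainWeightRoot; fun_prop

theorem bourgainWeight_eq_sq (α s ω b : ℝ) (q : ℝ × ℝ) :
    bourgainWeight α s ω b q = bourgainWeightRoot α s ω b q ^ 2 := by
  have h : ∀ {x e : ℝ}, 0 ≤ x → (x ^ e) ^ 2 = x ^ (2 * e) := by
    intro x e hx
    rw [← Real.rpow_natCast, ← Real.rpow_mul hx]; congr 1; push_cast; ring
  rw [bourgainWeight, bourgainWeightRoot, mul_pow, mul_pow, mul_pow, h (abs_nonneg _),
    h (jbracket_pos _).le, h (jbracket_pos _).le, h (jbracket_pos _).le]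
  congr 4 <;> ring

theorem bourgainWeightRoot_eq_exp {q : ℝ × ℝ} (hq : q.2 ≠ 0) :
    bourgainWeightRoot α s ω b q = Real.exp (-ω * Real.log |q.2| + (s - α * ω) * logFreq q +
      ω * logSize α q + b * logMod α q) := by
  rw [bourgainWeightRoot, Real.rpow_def_of_pos (abs_pos.2 hq),
    Real.rpow_def_of_pos (jbracket_pos _), Real.rpow_def_of_pos (jbracket_pos _),
    Real.rpow_def_of_pos (jbracket_pos _), ← Real.exp_add, ← Real.exp_add, ← Real.exp_add,
    logFreq, logSize, logMod]
  congr 1; ring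

theorem bourgainWeightRoot_eq_mul (α s s' ω b : ℝ) (q : ℝ × ℝ) :
    bourgainWeightRoot α s ω b q =
      jbracket q.2 ^ (s - s') * bourgainWeightRoot α s' ω b q := by
  rw [bourgainWeightRoot, bourgainWeightRoot,
    show s - α * ω = (s - s') + (s' - α * ω) by ring, Real.rpow_add (jbracket_pos _)]
  ring

theorem bourgainWeightRoot_mono (α ω b : ℝ) (h : s' ≤ s) (q : ℝ × ℝ) :
    bourgainWeightRoot α s' ω b q ≤ bourgainWeightRoot α s ω b q := by
  rw [bourgainWeightRoot_eq_mul α s s']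
  exact le_mul_of_one_le_left (bourgainWeightRoot_nonneg _ _ _ _ _)
    (Real.one_le_rpow (one_le_jbracket _) (by linarith))

theorem jbracket_add_rpow_le {e : ℝ} (he : 0 ≤ e) (x y : ℝ) :
    jbracket (x + y) ^ e ≤ 2 ^ e * (jbracket x ^ e + jbracket y ^ e) := by
  wlog h : jbracket y ≤ jbracket x generalizing x y
  · rw [add_comm x, add_comm (jbracket x ^ e)]
    exact this y x (le_of_not_ge h)
  calc jbracket (x + y) ^ e ≤ (2 * jbracket x) ^ e :=
        Real.rpow_le_rpow (jbracket_pos _).le (by linarith [jbracket_add_le x y]) he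
    _ = 2 ^ e * jbracket x ^ e := Real.mul_rpow (by norm_num) (jbracket_pos _).le
    _ ≤ _ := by
        gcongr
        exact le_add_of_nonneg_right (Real.rpow_pos_of_pos (jbracket_pos _) _).le

theorem abs_mul_weightRoot_le (h : ExponentData α ω p ε) {a c : ℝ × ℝ} (ha : a.2 ≠ 0)
    (hc : c.2 ≠ 0) :
    |(a + c).2| * bourgainWeightRoot α (-p) ω (-1 / 2 + 2 * ε) (a + c) ≤
      Real.exp 40 * (3 * kernelSum α (1 / 2 + ε) a c) *
        (bourgainWeightRoot α (-p) ω (1 / 2 + ε) a *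
          bourgainWeightRoot α (-p) ω (1 / 2 + ε) c) := by
  by_cases hac : (a + c).2 = 0
  · rw [hac, abs_zero, zero_mul]
    have := kernelSum_nonneg α (1 / 2 + ε) a c
    exact mul_nonneg (by positivity)
      (mul_nonneg (bourgainWeightRoot_nonneg _ _ _ _ _) (bourgainWeightRoot_nonneg _ _ _ _ _))
  have key : |(a + c).2| * bourgainWeightRoot α (-p) ω (-1 / 2 + 2 * ε) (a + c) =
      Real.exp (logMultiplier α ω p ε a c) *
        (bourgainWeightRoot α (-p) ω (1 / 2 + ε) a *
          bourgainWeightRoot α (-p) ω (1 / 2 + ε) c) := by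
    rw [bourgainWeightRoot_eq_exp hac, bourgainWeightRoot_eq_exp ha, bourgainWeightRoot_eq_exp hc,
      ← Real.exp_add, ← Real.exp_add]
    nth_rewrite 1 [← Real.exp_log (abs_pos.2 hac)]
    rw [← Real.exp_add, logMultiplier, logSymbol]
    congr 1; ring
  rw [key]
  exact mul_le_mul_of_nonneg_right (exp_logMultiplier_le h ha hc hac)
    (mul_nonneg (bourgainWeightRoot_nonneg _ _ _ _ _) (bourgainWeightRoot_nonneg _ _ _ _ _))

/-- Weights at the levels `s` and `-p` differ by `⟨ξ⟩^{s+p}`, and subadditivity of the bracket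
places this power on one input at a time. The other input stays at level `-p`, below `s₀`. -/
theorem abs_mul_weightRoot_le_add (h : ExponentData α ω p ε) {s₀ : ℝ} (hps : -p ≤ s₀)
    (hs : s₀ ≤ s) {a c : ℝ × ℝ} (ha : a.2 ≠ 0) (hc : c.2 ≠ 0) :
    |(a + c).2| * bourgainWeightRoot α s ω (-1 / 2 + 2 * ε) (a + c) ≤
      (2 ^ (s + p) * Real.exp 40 * 3) * (kernelSum α (1 / 2 + ε) a c *
        (bourgainWeightRoot α s ω (1 / 2 + ε) a * bourgainWeightRoot α s₀ ω (1 / 2 + ε) c +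
          bourgainWeightRoot α s₀ ω (1 / 2 + ε) a * bourgainWeightRoot α s ω (1 / 2 + ε) c)) := by
  have hk := kernelSum_nonneg α (1 / 2 + ε) a c
  have hw := fun s q => bourgainWeightRoot_nonneg α s ω (1 / 2 + ε) q
  have hJ : jbracket (a + c).2 ^ (s + p) ≤ _ := jbracket_add_rpow_le (by linarith) a.2 c.2
  have hpos := fun x => (Real.rpow_pos_of_pos (jbracket_pos x) (s + p)).le
  have hmain := abs_mul_weightRoot_le h ha hc
  have e := fun b q => bourgainWeightRoot_eq_mul α s (-p) ω b q
  simp only [sub_neg_eq_add] at e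
  set W := bourgainWeightRoot α (-p) ω (1 / 2 + ε)
  calc _ = jbracket (a + c).2 ^ (s + p) *
        (|(a + c).2| * bourgainWeightRoot α (-p) ω (-1 / 2 + 2 * ε) (a + c)) := by rw [e]; ring
    _ ≤ (2 ^ (s + p) * (jbracket a.2 ^ (s + p) + jbracket c.2 ^ (s + p))) *
        (Real.exp 40 * (3 * kernelSum α (1 / 2 + ε) a c) * (W a * W c)) := by
        refine mul_le_mul hJ hmain (mul_nonneg (abs_nonneg _) (bourgainWeightRoot_nonneg _ _ _ _ _))
          (mul_nonneg (by positivity) (add_nonneg (hpos _) (hpos _)))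
    _ = (2 ^ (s + p) * Real.exp 40 * 3) * (kernelSum α (1 / 2 + ε) a c *
        (bourgainWeightRoot α s ω (1 / 2 + ε) a * W c +
          W a * bourgainWeightRoot α s ω (1 / 2 + ε) c)) := by rw [e, e]; ring
    _ ≤ _ := by
        have h1 := bourgainWeightRoot_mono α ω (1 / 2 + ε) hps a
        have h2 := bourgainWeightRoot_mono α ω (1 / 2 + ε) hps c
        gcongr
        · exact hw _ _
        · exact hw _ _

end Weights

/-! ### The norm estimate. -/

section Norms

/-- The weighted space-time Fourier transform whose `L²` norm is the Bourgain norm. -/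
noncomputable def weightedFourier (α s ω b : ℝ) (u : ℝ × ℝ → ℂ) (q : ℝ × ℝ) : ℝ≥0∞ :=
  ENNReal.ofReal (bourgainWeightRoot α s ω b q) * ‖spacetimeFourier u q‖ₑ

theorem bourgainNorm_sq (α s ω b : ℝ) (u : ℝ × ℝ → ℂ) :
    bourgainNorm α s ω b u ^ 2 = ∫⁻ q, weightedFourier α s ω b u q ^ 2 := by
  rw [bourgainNorm, ← ENNReal.rpow_natCast, ← ENNReal.rpow_mul]
  norm_num
  refine lintegral_congr fun q => ?_
  rw [weightedFourier, bourgainWeight_eq_sq, ENNReal.ofReal_mul (by positivity),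
    ENNReal.ofReal_pow (bourgainWeightRoot_nonneg _ _ _ _ _), ENNReal.ofReal_pow (norm_nonneg _),
    ofReal_norm, mul_pow]

theorem measurable_weightedFourier (α s ω b : ℝ) (u : 𝓢(ℝ × ℝ, ℂ)) :
    Measurable (weightedFourier α s ω b u) := by
  have := (continuous_spacetimeFourier u).measurable
  unfold weightedFourier
  fun_prop

theorem ae_snd_ne (c : ℝ) : ∀ᵐ r : ℝ × ℝ, r.2 ≠ c := by
  have h : {r : ℝ × ℝ | ¬ r.2 ≠ c} = Set.univ ×ˢ {c} := by ext r; simp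
  rw [ae_iff, h, Measure.volume_eq_prod, Measure.prod_prod]
  simp

theorem add_sq_le_four_mul (x y : ℝ≥0∞) : (x + y) ^ 2 ≤ 4 * (x ^ 2 + y ^ 2) := by
  wlog h : y ≤ x generalizing x y
  · rw [add_comm x, add_comm (x ^ 2)]; exact this y x (le_of_not_ge h)
  calc (x + y) ^ 2 ≤ (2 * x) ^ 2 := by gcongr; rw [two_mul]; gcongr
    _ = 4 * x ^ 2 := by rw [mul_pow]; norm_num
    _ ≤ _ := by gcongr; exact le_self_add

theorem weightedFourier_partialX_mul_le {α s s₀ ω p ε : ℝ} (h : ExponentData α ω p ε)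
    (hps : -p ≤ s₀) (hs : s₀ ≤ s) (u₁ u₂ : 𝓢(ℝ × ℝ, ℂ)) (q : ℝ × ℝ) :
    weightedFourier α s ω (-1 / 2 + 2 * ε) (partialX fun p => u₁ p * u₂ p) q ≤
      ENNReal.ofReal (2 ^ (s + p) * Real.exp 40 * 3) *
      ∫⁻ r, pairSum (fun r r' => ENNReal.ofReal (bilinearKernel α (1 / 2 + ε) r r')) q r *
        (weightedFourier α s ω (1 / 2 + ε) u₁ r * weightedFourier α s₀ ω (1 / 2 + ε) u₂ (q - r) +
        weightedFourier α s₀ ω (1 / 2 + ε) u₁ r *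
          weightedFourier α s ω (1 / 2 + ε) u₂ (q - r)) := by
  have m1 := (continuous_spacetimeFourier u₁).measurable
  have m2 := (continuous_spacetimeFourier u₂).measurable
  have hw := fun s b q => bourgainWeightRoot_nonneg α s ω b q
  calc _ ≤ ENNReal.ofReal (bourgainWeightRoot α s ω (-1 / 2 + 2 * ε) q) * (‖q.2‖ₑ *
        ∫⁻ r : ℝ × ℝ, ‖spacetimeFourier u₁ r‖ₑ * ‖spacetimeFourier u₂ (q - r)‖ₑ) :=
        mul_le_mul' le_rfl (enorm_spacetimeFourier_partialX_mul_le u₁ u₂ q)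
    _ = ∫⁻ r : ℝ × ℝ, ENNReal.ofReal (|q.2| * bourgainWeightRoot α s ω (-1 / 2 + 2 * ε) q) *
        (‖spacetimeFourier u₁ r‖ₑ * ‖spacetimeFourier u₂ (q - r)‖ₑ) := by
        rw [lintegral_const_mul _ (by fun_prop), ENNReal.ofReal_mul (abs_nonneg _),
          Real.enorm_eq_ofReal_abs]
        ring
    _ ≤ ∫⁻ r, ENNReal.ofReal (2 ^ (s + p) * Real.exp 40 * 3) *
        (pairSum (fun r r' => ENNReal.ofReal (bilinearKernel α (1 / 2 + ε) r r')) q r *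
        (weightedFourier α s ω (1 / 2 + ε) u₁ r * weightedFourier α s₀ ω (1 / 2 + ε) u₂ (q - r) +
        weightedFourier α s₀ ω (1 / 2 + ε) u₁ r *
          weightedFourier α s ω (1 / 2 + ε) u₂ (q - r))) := by
        refine lintegral_mono_ae ?_
        -- The logarithmic bounds need nonzero input frequencies; the exceptional lines are null
        -- sets.
        filter_upwards [ae_snd_ne 0, ae_snd_ne q.2] with r hr hqr
        have hc : (q - r).2 ≠ 0 := sub_ne_zero.2 (Ne.symm hqr)
        have hp := abs_mul_weightRoot_le_add h hps hs hr hc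
        rw [add_sub_cancel] at hp
        have hpair : pairSum (fun r r' => ENNReal.ofReal (bilinearKernel α (1 / 2 + ε) r r')) q r =
            ENNReal.ofReal (kernelSum α (1 / 2 + ε) r (q - r)) := by
          have hk := fun x y => bilinearKernel_nonneg α (1 / 2 + ε) x y
          rw [pairSum, kernelSum, add_sub_cancel, ENNReal.ofReal_add (add_nonneg (hk _ _) (hk _ _))
            (hk _ _), ENNReal.ofReal_add (hk _ _) (hk _ _)]
        rw [hpair]
        simp only [weightedFourier]
        refine (mul_le_mul' (ENNReal.ofReal_le_ofReal hp) le_rfl).trans_eq ?_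
        rw [ENNReal.ofReal_mul (by positivity), ENNReal.ofReal_mul (kernelSum_nonneg _ _ _ _),
          ENNReal.ofReal_add (mul_nonneg (hw _ _ _) (hw _ _ _))
            (mul_nonneg (hw _ _ _) (hw _ _ _)),
          ENNReal.ofReal_mul (hw _ _ _), ENNReal.ofReal_mul (hw _ _ _)]
        ring
    _ = _ := by
        have hκ := measurable_pairSum (measurable_bilinearKernel α (1 / 2 + ε))
        have hκ' := hκ.comp (measurable_prodMk_left (x := q))
        simp only [Function.comp_def, Function.uncurry_apply_pair] at hκ'
        have n1 := fun s => measurable_weightedFourier α s ω (1 / 2 + ε) u₁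
        have n2 := fun s => measurable_weightedFourier α s ω (1 / 2 + ε) u₂
        have n1s := n1 s
        have n1s₀ := n1 s₀
        have n2s := n2 s
        have n2s₀ := n2 s₀
        rw [lintegral_const_mul _ (by fun_prop)]

theorem exists_bourgainNorm_partialX_mul_le {α s s₀ ω p ε : ℝ} (h : ExponentData α ω p ε)
    (hps : -p ≤ s₀) (hs : s₀ ≤ s) :
    ∃ c : ℝ≥0, ∀ u₁ u₂ : 𝓢(ℝ × ℝ, ℂ),
      bourgainNorm α s ω (-1 / 2 + 2 * ε) (partialX fun p => u₁ p * u₂ p) ≤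
        (c : ℝ≥0∞) * (bourgainNorm α s ω (1 / 2 + ε) u₁ * bourgainNorm α s₀ ω (1 / 2 + ε) u₂ +
          bourgainNorm α s₀ ω (1 / 2 + ε) u₁ * bourgainNorm α s ω (1 / 2 + ε) u₂) := by
  obtain ⟨C, hC⟩ := exists_lintegral_bilinearKernel_sq_le h.one_lt
    (b := 1 / 2 + ε) (by linarith [h.eps_pos])
  set D : ℝ≥0 := (2 ^ (s + p) * Real.exp 40 * 3).toNNReal with hD
  -- The two Schur bounds give `4 * 27 = 108`, rounded up to the square `121 = 11²`.
  refine ⟨D * (11 * NNReal.sqrt C), fun u₁ u₂ => ?_⟩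
  set κ : ℝ × ℝ → ℝ × ℝ → ℝ≥0∞ :=
    fun r r' => ENNReal.ofReal (bilinearKernel α (1 / 2 + ε) r r') with hκ
  have hκm : Measurable (Function.uncurry κ) := measurable_bilinearKernel α (1 / 2 + ε)
  have n1 := fun s => measurable_weightedFourier α s ω (1 / 2 + ε) u₁
  have n2 := fun s => measurable_weightedFourier α s ω (1 / 2 + ε) u₂
  have hpair := measurable_pairSum hκm
  have b1 := lintegral_sq_convolution_pairSum_le hκm (n1 s) (n2 s₀) hC
  have b2 := lintegral_sq_convolution_pairSum_le hκm (n1 s₀) (n2 s) hC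
  simp only [← bourgainNorm_sq] at b1 b2
  set A := bourgainNorm α s ω (1 / 2 + ε) u₁ * bourgainNorm α s₀ ω (1 / 2 + ε) u₂
  set B := bourgainNorm α s₀ ω (1 / 2 + ε) u₁ * bourgainNorm α s ω (1 / 2 + ε) u₂
  have hI : ∀ {f g : ℝ × ℝ → ℝ≥0∞}, Measurable f → Measurable g →
      Measurable fun q => ∫⁻ r, pairSum κ q r * (f r * g (q - r)) := by
    intro f g hf hg
    exact Measurable.lintegral_prod_right' (f := fun x : (ℝ × ℝ) × (ℝ × ℝ) =>
      Function.uncurry (pairSum κ) x * (f x.2 * g (x.1 - x.2))) (by fun_prop)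
  have n1s := n1 s
  have n1s₀ := n1 s₀
  have n2s := n2 s
  have n2s₀ := n2 s₀
  have i1 := hI n1s n2s₀
  have i2 := hI n1s₀ n2s
  have hsq : bourgainNorm α s ω (-1 / 2 + 2 * ε) (partialX fun p => u₁ p * u₂ p) ^ 2 ≤
      ((D * (11 * NNReal.sqrt C) : ℝ≥0) * (A + B)) ^ 2 := by
    rw [bourgainNorm_sq]
    calc _ ≤ ∫⁻ q, (D : ℝ≥0∞) ^ 2 * (4 * ((∫⁻ r, pairSum κ q r *
          (weightedFourier α s ω (1 / 2 + ε) u₁ r *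
            weightedFourier α s₀ ω (1 / 2 + ε) u₂ (q - r))) ^ 2 +
          (∫⁻ r, pairSum κ q r * (weightedFourier α s₀ ω (1 / 2 + ε) u₁ r *
            weightedFourier α s ω (1 / 2 + ε) u₂ (q - r))) ^ 2)) := by
          refine lintegral_mono fun q => ?_
          refine (pow_le_pow_left' (weightedFourier_partialX_mul_le h hps hs u₁ u₂ q) 2).trans ?_
          rw [mul_pow]
          refine mul_le_mul' le_rfl ?_
          refine le_trans (le_of_eq ?_) (add_sq_le_four_mul _ _)
          have hpq := hpair.comp (measurable_prodMk_left (x := q))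
          simp only [Function.comp_def, Function.uncurry_apply_pair] at hpq
          rw [← lintegral_add_left (by fun_prop)]
          simp only [mul_add, hκ]
      _ = (D : ℝ≥0∞) ^ 2 * (4 * ((∫⁻ q, (∫⁻ r, pairSum κ q r *
          (weightedFourier α s ω (1 / 2 + ε) u₁ r *
            weightedFourier α s₀ ω (1 / 2 + ε) u₂ (q - r))) ^ 2) +
          ∫⁻ q, (∫⁻ r, pairSum κ q r * (weightedFourier α s₀ ω (1 / 2 + ε) u₁ r *
            weightedFourier α s ω (1 / 2 + ε) u₂ (q - r))) ^ 2)) := by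
          rw [lintegral_const_mul _ (by fun_prop), lintegral_const_mul _ (by fun_prop),
            lintegral_add_left (by fun_prop)]
      _ ≤ (D : ℝ≥0∞) ^ 2 * (4 * (27 * C * A ^ 2 + 27 * C * B ^ 2)) := by
          simp only [A, B, mul_pow]
          gcongr
      _ = (D : ℝ≥0∞) ^ 2 * C * (108 * (A ^ 2 + B ^ 2)) := by ring
      _ ≤ (D : ℝ≥0∞) ^ 2 * C * (121 * (A + B) ^ 2) := by
          gcongr
          · norm_num
          · rw [add_sq, add_right_comm]; exact le_self_add
      _ = _ := by
          have hCC : (C : ℝ≥0∞) = (NNReal.sqrt C : ℝ≥0∞) ^ 2 := by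
            rw [← ENNReal.coe_pow, NNReal.sq_sqrt]
          rw [hCC]
          push_cast
          ring
  exact (ENNReal.pow_le_pow_left_iff two_ne_zero).1 hsq

end Norms

/-! ### Choice of the parameters. -/

theorem theorem3p1 (α s s₀ ω : ℝ) (hα₁ : 1 < α) (hα₂ : α < 2)
    (hs : s₀ ≤ s) (hs₀ : -(3 / 4 : ℝ) * (α - 1) < s₀) (hω : ω = 1 / α - 1 / 2) :
    ∃ b' : ℝ, -(1 / 2 : ℝ) < b' ∧ ∃ b : ℝ, 1 / 2 < b ∧ b < b' + 1 ∧
      ∃ c : ℝ≥0, ∀ u₁ u₂ : 𝓢(ℝ × ℝ, ℂ),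
        bourgainNorm α s ω b' (partialX fun p => u₁ p * u₂ p) ≤
          (c : ℝ≥0∞) *
            (bourgainNorm α s ω b u₁ * bourgainNorm α s₀ ω b u₂ +
              bourgainNorm α s₀ ω b u₁ * bourgainNorm α s ω b u₂) := by
  -- The exponent inequalities need `p ≥ 0`; for positive `s₀` the level `0` is used, and
  -- monotonicity of the weights in `s` recovers `s₀`.
  set p : ℝ := max (-s₀) 0
  have hp : p < 3 / 4 * (α - 1) := max_lt (by linarith) (by linarith)
  set ε : ℝ := (3 / 4 * (α - 1) - p) / 12 with hε
  have hε0 : 0 < ε := by linarith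
  have hm : α * ω = 1 - α / 2 := by
    rw [hω]; field_simp
  have hdata : ExponentData α ω p ε :=
    { one_lt := hα₁
      lt_two := hα₂
      mul_eq := hm
      omega_nonneg := by nlinarith
      omega_le := by nlinarith
      p_nonneg := le_max_right _ _
      eps_pos := hε0
      p_le := by linarith }
  have hps : -p ≤ s₀ := by linarith [le_max_left (-s₀) 0]
  -- The excess `2ε` in `b'` against `ε` in `b` makes `b < b' + 1` strict.
  exact ⟨-1 / 2 + 2 * ε, by linarith, 1 / 2 + ε, by linarith, by linarith,
    exists_bourgainNorm_partialX_mul_le hdata hps hs⟩
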